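/- Let $\alpha\in(0,1)$, $\beta\in(0,1]$ and $\frac1{\alpha\beta}<p<\infty$. Let $(B^{\alpha,\beta}(t))_{t\ge 0}$ be a bifractional Brownian motion with parameters $\alpha,\beta$, i.e. a centred real Gaussian process with covariance $$\mathbb E\big[B^{\alpha,\beta}(s)B^{\alpha,\beta}(t)\big]=\frac1{2^{\beta}}\Big((t^{2\alpha}+s^{2\alpha})^{\beta}-|t-s|^{2\alpha\beta}\Big),\qquad s,t\ge 0,$$ whose sample paths are almost surely continuous on $[0,1]$. For a measurable $f:[0,1]\to\mathbb R$ and $t>0$ put $$\Delta_p(f)(t)=\sup_{|s|\le t}\Big(\int_{\{x\in[0,1]:\,x+s\in[0,1]\}}|f(x+s)-f(x)|^p\,dx\Big)^{1/p},$$ and for $\gamma>0$ let $$\mathbf{Bes}(\gamma,p)=\Big\{f\in L^p([0,1]):\ \|f\|_{L^p([0,1])}+\sup_{0<t\le 1}\frac{\Delta_p(f)(t)}{t^{\gamma}}<\infty\Big\},$$ $$\mathbf{bes}(\gamma,p)=\Big\{f\in L^p([0,1]):\ \Delta_p(f)(t)=o(t^{\gamma})\ \text{as } t\to 0^+\Big\}.$$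 Then almost surely the sample path $t\in[0,1]\mapsto B^{\alpha,\beta}(t)$ belongs to $\mathbf{Bes}(\alpha\beta,p)$, and almost surely it does not belong to $\mathbf{bes}(\alpha\beta,p)$. -/

import Mathlib

open MeasureTheory ProbabilityTheory Filter Topology
open scoped NNReal ENNReal

noncomputable section

/-- The covariance function
`R(s,t) = 2^{-β} ((t^{2α} + s^{2α})^β - |t - s|^{2αβ})`
of the bifractional Brownian motion. -/
def bbmCovariance (α β : ℝ) (s t : ℝ≥0) : ℝ :=
  1 / 2 ^ β *
    (((t : ℝ) ^ (2 * α) + (s : ℝ) ^ (2 * α)) ^ β - |(t : ℝ) - (s : ℝ)| ^ (2 * α * β))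

/-- `(B t)_{t ≥ 0}` is a bifractional Brownian motion with parameters `α`, `β` under `P`:
a centred real Gaussian process with covariance function `bbmCovariance α β`. -/
structure IsBifractionalBrownianMotion {Ω : Type*} [MeasurableSpace Ω] (α β : ℝ)
    (B : ℝ≥0 → Ω → ℝ) (P : Measure Ω) : Prop where
  isGaussianProcess : IsGaussianProcess B P
  centered : ∀ t, ∫ ω, B t ω ∂P = 0
  covariance_eq : ∀ s t, cov[B s, B t; P] = bbmCovariance α β s t

/-- The sample path `t ↦ B t ω`, as a function of a real variable. Only its values on `[0,1]`
matter below; at negative reals it takes the value `B 0 ω`. -/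
def samplePath {Ω : Type*} (B : ℝ≥0 → Ω → ℝ) (ω : Ω) : ℝ → ℝ :=
  fun t => B t.toNNReal ω

/-- The `L^p` modulus of continuity
`Δ_p(f,I)(t) = sup_{|s| ≤ t} (∫_{I_s} |f(x+s) - f(x)|^p dx)^{1/p}`,
`I_s = {x ∈ I : x + s ∈ I}`, with values in `[0,∞]`. -/
def lpModulus (p : ℝ) (f : ℝ → ℝ) (I : Set ℝ) (t : ℝ) : ℝ≥0∞ :=
  ⨆ (s : ℝ) (_ : |s| ≤ t),
    (∫⁻ x in {x | x ∈ I ∧ x + s ∈ I}, ENNReal.ofReal |f (x + s) - f x| ^ p) ^ (1 / p)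

/-- The Besov norm `‖f‖_{L^p(I)} + sup_{0 < t ≤ 1} Δ_p(f,I)(t) / t^γ`, with values in `[0,∞]`. -/
def besovNorm (γ p : ℝ) (I : Set ℝ) (f : ℝ → ℝ) : ℝ≥0∞ :=
  eLpNorm f (ENNReal.ofReal p) (volume.restrict I) +
    ⨆ (t : ℝ) (_ : 0 < t ∧ t ≤ 1), lpModulus p f I t / ENNReal.ofReal (t ^ γ)

/-- The Besov space `Bes(γ,p)(I)`: the `f ∈ L^p(I)` of finite Besov norm. -/
def Bes (γ p : ℝ) (I : Set ℝ) : Set (ℝ → ℝ) :=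
  {f | MemLp f (ENNReal.ofReal p) (volume.restrict I) ∧ besovNorm γ p I f < ∞}

/-- The little Besov space `bes(γ,p)(I)`: the `f ∈ L^p(I)` with
`Δ_p(f,I)(t) = o(t^γ)` as `t → 0⁺`. -/
def bes (γ p : ℝ) (I : Set ℝ) : Set (ℝ → ℝ) :=
  {f | MemLp f (ENNReal.ofReal p) (volume.restrict I) ∧
    Tendsto (fun t : ℝ => lpModulus p f I t / ENNReal.ofReal (t ^ γ)) (𝓝[>] 0) (𝓝 0)}

end

/-! Put γ = αβ. Everything rests on the energy V_h, the integral over [0, 1 - h] of |h^(-γ)(B(x+h) -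
B(x))|^p. Along h = 2^(-n) it is almost surely bounded and eventually bounded below by a positive
constant (`ae_incrementEnergy_bounds`).

The mean of V_h is of order one, because the scaled increments have variance at most 2, and at least
1/2 for x ≥ √h and small h. For the fluctuation, the covariance of two scaled increments is a mixed
second difference of the covariance kernel. Its two terms are smooth away from the axes and from the
diagonal respectively, so for points at distance at least √h from 0 and from each other this
covariance is O(h^(1-γ)). A Gaussian regression argument (`abs_covariance_abs_rpow_le`) carries the
bound over to p-th powers, and the remaining pairs have measure O(√h). Hence V_h differs from its
mean by O(h^(1-γ) + √h) in mean square (`integral_sq_incrementEnergy_sub_le`). This is summable over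
dyadic h, so the difference tends to 0 almost surely.

The rest is deterministic. The L^p norm of a translation difference is subadditive in the shift, so
bounds at dyadic shifts extend by binary expansion and Fatou to all shifts in [0, 1], which gives
membership in `Bes` (`mem_Bes_of_incrementEnergy_le`). The lower bound at the shifts 2^(-n) already
prevents the modulus from being o(t^γ) (`notMem_bes_of_le_incrementEnergy`). -/

/-! ### Mixed second differences of the two covariance kernels -/

/-- The mixed second difference of `K` over the square with lower left corner `(x, y)`
and side `h`. -/
def mixedDiff (K : ℝ → ℝ → ℝ) (x y h : ℝ) : ℝ :=
  K (x + h) (y + h) - K (x + h) y - K x (y + h) + K x y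

/-- Mean value inequality twice: in `t` for `K₁`, then in `s` for the difference `K s (y + h) - K s
y`, whose derivative the first application bounds by `M * h`. -/
lemma abs_mixedDiff_le {K K₁ K₁₂ : ℝ → ℝ → ℝ} {x y h M : ℝ} (hh : 0 ≤ h)
    (h₁ : ∀ s ∈ Set.Icc x (x + h), ∀ t ∈ Set.Icc y (y + h),
      HasDerivAt (fun s => K s t) (K₁ s t) s)
    (h₂ : ∀ s ∈ Set.Icc x (x + h), ∀ t ∈ Set.Icc y (y + h),
      HasDerivAt (fun t => K₁ s t) (K₁₂ s t) t)
    (hM : ∀ s ∈ Set.Icc x (x + h), ∀ t ∈ Set.Icc y (y + h), |K₁₂ s t| ≤ M) :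
    |mixedDiff K x y h| ≤ M * h ^ 2 := by
  have hx : x ∈ Set.Icc x (x + h) := ⟨le_rfl, by linarith⟩
  have hx' : x + h ∈ Set.Icc x (x + h) := ⟨by linarith, le_rfl⟩
  have hy : y ∈ Set.Icc y (y + h) := ⟨le_rfl, by linarith⟩
  have hy' : y + h ∈ Set.Icc y (y + h) := ⟨by linarith, le_rfl⟩
  have step : ∀ s ∈ Set.Icc x (x + h), ‖K₁ s (y + h) - K₁ s y‖ ≤ M * h := by
    intro s hs
    have := (convex_Icc y (y + h)).norm_image_sub_le_of_norm_hasDerivWithin_le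
      (f := fun t => K₁ s t) (f' := fun t => K₁₂ s t) (C := M)
      (fun t ht => (h₂ s hs t ht).hasDerivWithinAt) (fun t ht => hM s hs t ht) hy hy'
    simpa [abs_of_nonneg hh] using this
  have := (convex_Icc x (x + h)).norm_image_sub_le_of_norm_hasDerivWithin_le
      (f := fun s => K s (y + h) - K s y) (f' := fun s => K₁ s (y + h) - K₁ s y) (C := M * h)
      (fun s hs => ((h₁ s hs _ hy').sub (h₁ s hs _ hy)).hasDerivWithinAt) step hx hx'
  have h3 : ‖x + h - x‖ = h := by simp [abs_of_nonneg hh]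
  rw [h3, Real.norm_eq_abs] at this
  calc |mixedDiff K x y h| = |K (x + h) (y + h) - K (x + h) y - (K x (y + h) - K x y)| := by
        unfold mixedDiff; ring_nf
    _ ≤ M * h * h := this
    _ = M * h ^ 2 := by ring

lemma two_mul_rpow_le_add {α s t : ℝ} (hs : 0 ≤ s) (ht : 0 ≤ t) :
    2 * (s * t) ^ α ≤ s ^ (2 * α) + t ^ (2 * α) := by
  have e : ∀ u : ℝ, 0 ≤ u → u ^ (2 * α) = (u ^ α) ^ 2 := fun u hu => by
    rw [mul_comm, Real.rpow_mul hu]; norm_cast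
  rw [e s hs, e t ht, Real.mul_rpow hs ht]
  nlinarith [sq_nonneg (s ^ α - t ^ α)]

/-- The mixed derivative is 4α²β(β-1)(st)^(2α-1)(s^(2α)+t^(2α))^(β-2). Since β - 2 < 0, the
arithmetic-geometric inequality bounds it by 4(st)^(αβ-1), which is largest at s = t = r. -/
lemma abs_mixedDiff_powSum_le {α β x y h r : ℝ} (hα0 : 0 < α) (hα1 : α < 1) (hβ0 : 0 < β)
    (hβ1 : β ≤ 1) (hr : 0 < r) (hx : r ≤ x) (hy : r ≤ y) (hh : 0 ≤ h) :
    |mixedDiff (fun s t => (s ^ (2 * α) + t ^ (2 * α)) ^ β) x y h|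
      ≤ 4 * r ^ (2 * (α * β) - 2) * h ^ 2 := by
  refine abs_mixedDiff_le
    (K₁ := fun s t => (2 * α * s ^ (2 * α - 1)) * β * (s ^ (2 * α) + t ^ (2 * α)) ^ (β - 1))
    (K₁₂ := fun s t => (2 * α * s ^ (2 * α - 1)) * β *
      ((2 * α * t ^ (2 * α - 1)) * (β - 1) * (s ^ (2 * α) + t ^ (2 * α)) ^ (β - 1 - 1))) hh ?_ ?_ ?_
  · intro s hs t ht
    have s0 : 0 < s := hr.trans_le (hx.trans hs.1)
    have t0 : 0 < t := hr.trans_le (hy.trans ht.1)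
    have pos : 0 < s ^ (2 * α) + t ^ (2 * α) := by positivity
    exact ((Real.hasDerivAt_rpow_const (p := 2 * α) (Or.inl s0.ne')).add_const
      (t ^ (2 * α))).rpow_const (Or.inl pos.ne')
  · intro s hs t ht
    have s0 : 0 < s := hr.trans_le (hx.trans hs.1)
    have t0 : 0 < t := hr.trans_le (hy.trans ht.1)
    have pos : 0 < s ^ (2 * α) + t ^ (2 * α) := by positivity
    exact (((Real.hasDerivAt_rpow_const (p := 2 * α) (Or.inl t0.ne')).const_add
      (s ^ (2 * α))).rpow_const (Or.inl pos.ne')).const_mul _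
  · intro s hs t ht
    have hs' : r ≤ s := hx.trans hs.1
    have ht' : r ≤ t := hy.trans ht.1
    have s0 : 0 < s := hr.trans_le hs'
    have t0 : 0 < t := hr.trans_le ht'
    have st : 0 < s * t := by positivity
    have base : (s ^ (2 * α) + t ^ (2 * α)) ^ (β - 1 - 1) ≤ (s * t) ^ (α * (β - 2)) := by
      rw [Real.rpow_mul st.le, show β - 1 - 1 = β - 2 by ring]
      refine Real.rpow_le_rpow_of_nonpos (by positivity) ?_ (by linarith)
      have := two_mul_rpow_le_add (α := α) s0.le t0.le
      have : 0 < (s * t) ^ α := by positivity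
      linarith
    have comb : s ^ (2 * α - 1) * t ^ (2 * α - 1) * (s * t) ^ (α * (β - 2))
        = (s * t) ^ (α * β - 1) := by
      rw [← Real.mul_rpow s0.le t0.le, ← Real.rpow_add st]; congr 1; ring
    have fin : (s * t) ^ (α * β - 1) ≤ r ^ (2 * (α * β) - 2) := by
      have : r ^ (2 * (α * β) - 2) = (r * r) ^ (α * β - 1) := by
        rw [Real.mul_rpow hr.le hr.le, ← Real.rpow_add hr]; congr 1; ring
      rw [this]
      refine Real.rpow_le_rpow_of_nonpos (by positivity) (by gcongr) (by nlinarith)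
    set A := s ^ (2 * α - 1) with hA
    set D := t ^ (2 * α - 1) with hD
    set E := (s ^ (2 * α) + t ^ (2 * α)) ^ (β - 1 - 1) with hE
    have A0 : 0 ≤ A := by positivity
    have D0 : 0 ≤ D := by positivity
    have E0 : 0 ≤ E := by positivity
    have eq : |2 * α * A * β * (2 * α * D * (β - 1) * E)|
        = (4 * (α * α) * (β * (1 - β))) * (A * D * E) := by
      rw [show 2 * α * A * β * (2 * α * D * (β - 1) * E)
        = -((4 * (α * α) * (β * (1 - β))) * (A * D * E)) by ring, abs_neg, abs_of_nonneg]
      have : 0 ≤ 1 - β := by linarith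
      positivity
    rw [eq]
    have c1 : 4 * (α * α) * (β * (1 - β)) ≤ 4 := by
      have u1 : α * α ≤ 1 := by nlinarith
      have u2 : β * (1 - β) ≤ 1 := by nlinarith
      have u3 : 0 ≤ β * (1 - β) := mul_nonneg hβ0.le (by linarith)
      nlinarith
    calc (4 * (α * α) * (β * (1 - β))) * (A * D * E) ≤ 4 * (A * D * E) := by gcongr
      _ ≤ 4 * (A * D * (s * t) ^ (α * (β - 2))) := by gcongr
      _ = 4 * (s * t) ^ (α * β - 1) := by rw [comb]
      _ ≤ _ := by gcongr

/-- The kernel is singular only on the diagonal, and the gap keeps t - s ≥ r on the whole square.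
The factor 2 bounds |2γ(2γ-1)|. -/
lemma abs_mixedDiff_abs_sub_rpow_le {γ x y h r : ℝ} (hγ0 : 0 < γ) (hγ1 : γ < 1) (hr : 0 < r)
    (hxy : x + h + r ≤ y) (hh : 0 ≤ h) :
    |mixedDiff (fun s t => |t - s| ^ (2 * γ)) x y h| ≤ 2 * r ^ (2 * γ - 2) * h ^ 2 := by
  have key : |mixedDiff (fun s t => (t - s) ^ (2 * γ)) x y h| ≤ 2 * r ^ (2 * γ - 2) * h ^ 2 := by
    refine abs_mixedDiff_le
      (K₁ := fun s t => (-1) * (2 * γ) * (t - s) ^ (2 * γ - 1))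
      (K₁₂ := fun s t => (-1) * (2 * γ) * (1 * (2 * γ - 1) * (t - s) ^ (2 * γ - 1 - 1))) hh ?_ ?_ ?_
    · intro s hs t ht
      have pos : 0 < t - s := by linarith [hs.2, ht.1]
      exact ((hasDerivAt_id s).const_sub t).rpow_const (Or.inl pos.ne')
    · intro s hs t ht
      have pos : 0 < t - s := by linarith [hs.2, ht.1]
      exact (((hasDerivAt_id t).sub_const s).rpow_const (Or.inl pos.ne')).const_mul _
    · intro s hs t ht
      have pos : r ≤ t - s := by linarith [hs.2, ht.1]
      have e : (t - s) ^ (2 * γ - 1 - 1) ≤ r ^ (2 * γ - 2) := by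
        rw [show 2 * γ - 1 - 1 = 2 * γ - 2 by ring]
        exact Real.rpow_le_rpow_of_nonpos hr pos (by linarith)
      have e0 : 0 ≤ (t - s) ^ (2 * γ - 1 - 1) := Real.rpow_nonneg (by linarith) _
      rw [← mul_assoc, abs_mul, abs_of_nonneg e0]
      have c : |-1 * (2 * γ) * (1 * (2 * γ - 1))| ≤ 2 := by
        rw [abs_le]; constructor <;> nlinarith
      gcongr
  have eq : mixedDiff (fun s t => |t - s| ^ (2 * γ)) x y h
      = mixedDiff (fun s t => (t - s) ^ (2 * γ)) x y h := by
    unfold mixedDiff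
    beta_reduce
    rw [abs_of_nonneg, abs_of_nonneg, abs_of_nonneg, abs_of_nonneg] <;> linarith
  rwa [eq]

/-! ### Gaussian moments and covariances of p-th powers -/

/-- The absolute moment of order `q` of the standard Gaussian distribution. -/
noncomputable def gaussianAbsMoment (q : ℝ) : ℝ := ∫ z, |z| ^ q ∂gaussianReal 0 1

lemma integrable_abs_rpow_gaussianReal {q : ℝ} (hq : 0 ≤ q) :
    Integrable (fun z => |z| ^ q) (gaussianReal 0 1) := by
  have h : MemLp (id : ℝ → ℝ) (ENNReal.ofReal q) (gaussianReal 0 1) :=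
    memLp_id_gaussianReal' _ ENNReal.ofReal_ne_top
  have := h.integrable_norm_rpow'
  simpa [ENNReal.toReal_ofReal hq] using this

lemma gaussianAbsMoment_nonneg (q : ℝ) : 0 ≤ gaussianAbsMoment q :=
  integral_nonneg fun _ => by positivity

lemma gaussianAbsMoment_pos {q : ℝ} (hq : 0 ≤ q) : 0 < gaussianAbsMoment q := by
  refine (integral_pos_iff_support_of_nonneg (fun _ => by positivity)
    (integrable_abs_rpow_gaussianReal hq)).2 ?_
  have hsub : ({0}ᶜ : Set ℝ) ⊆ Function.support fun z : ℝ => |z| ^ q := by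
    intro z hz
    have : 0 < |z| := abs_pos.2 hz
    exact (Real.rpow_pos_of_pos this q).ne'
  refine lt_of_lt_of_le ?_ (measure_mono hsub)
  have := nullSingletonClass_gaussianReal (μ := 0) (v := 1) one_ne_zero
  rw [prob_compl_eq_one_sub (measurableSet_singleton 0), measure_singleton]
  simp

section Gaussian

variable {Ω : Type*} [MeasurableSpace Ω] {P : Measure Ω} {U V : Ω → ℝ}

lemma integrable_abs_rpow_of_hasGaussianLaw {q : ℝ} (hq : 0 ≤ q) (hU : HasGaussianLaw U P) :
    Integrable (fun ω => |U ω| ^ q) P := by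
  have := hU.isProbabilityMeasure
  have := (hU.memLp (p := ENNReal.ofReal q) ENNReal.ofReal_ne_top).integrable_norm_rpow'
  simpa [ENNReal.toReal_ofReal hq] using this

lemma memLp_two_abs_rpow_of_hasGaussianLaw {q : ℝ} (hq : 0 ≤ q) (hU : HasGaussianLaw U P) :
    MemLp (fun ω => |U ω| ^ q) 2 P := by
  rw [memLp_two_iff_integrable_sq
    (integrable_abs_rpow_of_hasGaussianLaw hq hU).aestronglyMeasurable]
  refine (integrable_abs_rpow_of_hasGaussianLaw (q := q * 2) (by positivity) hU).congr
    (ae_of_all _ fun ω => ?_)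
  simp only
  rw [Real.rpow_mul (abs_nonneg _)]; norm_cast

/-- A centred Gaussian variable has the law of its standard deviation times a standard one. -/
lemma integral_abs_rpow_of_hasGaussianLaw {q : ℝ} (hU : HasGaussianLaw U P)
    (hU0 : P[U] = 0) : ∫ ω, |U ω| ^ q ∂P = √(Var[U; P]) ^ q * gaussianAbsMoment q := by
  have := hU.isProbabilityMeasure
  have hmeas : Measurable fun z : ℝ => |z| ^ q := by fun_prop
  have e1 : ∫ ω, |U ω| ^ q ∂P = ∫ z, |z| ^ q ∂(P.map U) :=
    (integral_map hU.aemeasurable hmeas.aestronglyMeasurable).symm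
  have e2 : P.map U = (gaussianReal 0 1).map (fun z => √(Var[U; P]) * z) := by
    rw [hU.map_eq_gaussianReal, hU0, gaussianReal_map_const_mul]
    congr 1
    · simp
    · ext
      simp [Real.sq_sqrt (variance_nonneg U P), variance_nonneg U P]
  rw [e1, e2, integral_map (by fun_prop) hmeas.aestronglyMeasurable, gaussianAbsMoment,
    ← integral_const_mul]
  congr 1; ext z
  rw [abs_mul, abs_of_nonneg (Real.sqrt_nonneg _),
    Real.mul_rpow (Real.sqrt_nonneg _) (abs_nonneg _)]

lemma integral_abs_rpow_le_of_hasGaussianLaw {q : ℝ} (hq : 0 ≤ q) (hU : HasGaussianLaw U P)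
    (hU0 : P[U] = 0) (hv : Var[U; P] ≤ 2) :
    ∫ ω, |U ω| ^ q ∂P ≤ √2 ^ q * gaussianAbsMoment q := by
  rw [integral_abs_rpow_of_hasGaussianLaw hU hU0]
  have := gaussianAbsMoment_nonneg q
  gcongr

lemma le_integral_abs_rpow_of_hasGaussianLaw {q : ℝ} (hq : 0 ≤ q) (hU : HasGaussianLaw U P)
    (hU0 : P[U] = 0) (hv : 1 / 2 ≤ Var[U; P]) :
    √(1 / 2) ^ q * gaussianAbsMoment q ≤ ∫ ω, |U ω| ^ q ∂P := by
  rw [integral_abs_rpow_of_hasGaussianLaw hU hU0]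
  have := gaussianAbsMoment_nonneg q
  gcongr

lemma add_add_rpow_le {a b c q : ℝ} (ha : 0 ≤ a) (hb : 0 ≤ b) (hc : 0 ≤ c) (hq : 0 ≤ q) :
    (a + b + c) ^ q ≤ 3 ^ q * (a ^ q + b ^ q + c ^ q) := by
  -- Here `m` plays the role of the maximum of the three numbers.
  have aux : ∀ m, 0 ≤ m → a ≤ m → b ≤ m → c ≤ m → m ^ q ≤ a ^ q + b ^ q + c ^ q →
      (a + b + c) ^ q ≤ 3 ^ q * (a ^ q + b ^ q + c ^ q) := by
    intro m hm h1 h2 h3 h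
    calc (a + b + c) ^ q ≤ (3 * m) ^ q := by gcongr; linarith
      _ = 3 ^ q * m ^ q := Real.mul_rpow (by norm_num) hm
      _ ≤ _ := by gcongr
  have pa : 0 ≤ a ^ q := by positivity
  have pb : 0 ≤ b ^ q := by positivity
  have pc : 0 ≤ c ^ q := by positivity
  rcases le_total a b with h1 | h1 <;> rcases le_total b c with h2 | h2 <;>
    rcases le_total a c with h3 | h3
  all_goals first
    | exact aux a ha le_rfl ‹_› ‹_› (by linarith)
    | exact aux b hb ‹_› le_rfl ‹_› (by linarith)
    | exact aux c hc ‹_› ‹_› le_rfl (by linarith)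
    | exact aux c hc (by linarith) (by linarith) le_rfl (by linarith)

lemma abs_rpow_sub_rpow_le {a b p : ℝ} (ha : 0 ≤ a) (hb : 0 ≤ b) (hp : 1 ≤ p) :
    |a ^ p - b ^ p| ≤ p * (a + b) ^ (p - 1) * |a - b| := by
  have := (convex_Icc (0 : ℝ) (a + b)).norm_image_sub_le_of_norm_hasDerivWithin_le
      (f := fun t => t ^ p) (f' := fun t => p * t ^ (p - 1)) (C := p * (a + b) ^ (p - 1))
      (fun t _ => (Real.hasDerivAt_rpow_const (Or.inr hp)).hasDerivWithinAt)
      (fun t ht => by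
        have h0 : 0 ≤ p * t ^ (p - 1) := mul_nonneg (by linarith) (Real.rpow_nonneg ht.1 _)
        rw [Real.norm_of_nonneg h0]
        have := Real.rpow_le_rpow ht.1 ht.2 (by linarith : 0 ≤ p - 1)
        gcongr)
      (x := b) (y := a) ⟨hb, by linarith⟩ ⟨ha, by linarith⟩
  simpa using this

/-- A bound for the moment of order `q` of `|U| + |V| + |Z|`, for centred Gaussian variables
`U`, `V`, `Z` of variance at most `2`. -/
noncomputable def gaussianSumMomentBound (q : ℝ) : ℝ := 3 ^ q * (3 * (√2 ^ q * gaussianAbsMoment q))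

lemma gaussianSumMomentBound_nonneg (q : ℝ) : 0 ≤ gaussianSumMomentBound q := by
  have := gaussianAbsMoment_nonneg q
  unfold gaussianSumMomentBound; positivity

lemma integral_add_add_rpow_le {q : ℝ} (hq : 0 ≤ q) {Z : Ω → ℝ} (hU : HasGaussianLaw U P)
    (hV : HasGaussianLaw V P) (hZ : HasGaussianLaw Z P) (hU0 : P[U] = 0) (hV0 : P[V] = 0)
    (hZ0 : P[Z] = 0) (hUv : Var[U; P] ≤ 2) (hVv : Var[V; P] ≤ 2) (hZv : Var[Z; P] ≤ 2) :
    Integrable (fun ω => (|U ω| + |V ω| + |Z ω|) ^ q) P ∧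
      ∫ ω, (|U ω| + |V ω| + |Z ω|) ^ q ∂P ≤ gaussianSumMomentBound q := by
  have iU := integrable_abs_rpow_of_hasGaussianLaw hq hU
  have iV := integrable_abs_rpow_of_hasGaussianLaw hq hV
  have iZ := integrable_abs_rpow_of_hasGaussianLaw hq hZ
  have iUV : Integrable (fun ω => |U ω| ^ q + |V ω| ^ q) P := iU.add iV
  have idom : Integrable (fun ω => 3 ^ q * (|U ω| ^ q + |V ω| ^ q + |Z ω| ^ q)) P :=
    (iUV.add iZ).const_mul (3 ^ q)
  have mU := hU.aemeasurable
  have mV := hV.aemeasurable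
  have mZ := hZ.aemeasurable
  have hle : ∀ ω, (|U ω| + |V ω| + |Z ω|) ^ q
      ≤ 3 ^ q * (|U ω| ^ q + |V ω| ^ q + |Z ω| ^ q) := fun ω =>
    add_add_rpow_le (abs_nonneg _) (abs_nonneg _) (abs_nonneg _) hq
  have iS : Integrable (fun ω => (|U ω| + |V ω| + |Z ω|) ^ q) P := by
    refine idom.mono' (by fun_prop) (ae_of_all _ fun ω => ?_)
    rw [Real.norm_of_nonneg (by positivity)]
    exact hle ω
  refine ⟨iS, (integral_mono iS idom hle).trans ?_⟩
  rw [integral_const_mul, integral_add iUV iZ, integral_add iU iV, gaussianSumMomentBound]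
  have bU := integral_abs_rpow_le_of_hasGaussianLaw hq hU hU0 hUv
  have bV := integral_abs_rpow_le_of_hasGaussianLaw hq hV hV0 hVv
  have bZ := integral_abs_rpow_le_of_hasGaussianLaw hq hZ hZ0 hZv
  gcongr
  linarith

/-- For jointly Gaussian centred `U`, `V` with variances of order one, the covariance of `|U|^p`
and `|V|^p` is controlled by the covariance of `U` and `V`. -/
lemma abs_covariance_abs_rpow_le {p : ℝ} (hp : 1 ≤ p)
    (hUV : HasGaussianLaw (fun ω => (U ω, V ω)) P) (hU0 : P[U] = 0) (hV0 : P[V] = 0)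
    (hUl : 1 / 2 ≤ Var[U; P]) (hUu : Var[U; P] ≤ 2) (hVu : Var[V; P] ≤ 2) :
    |cov[fun ω => |U ω| ^ p, fun ω => |V ω| ^ p; P]|
      ≤ 2 * p * (gaussianSumMomentBound (2 * p) + gaussianSumMomentBound p ^ 2)
        * |cov[U, V; P]| := by
  have := hUV.isProbabilityMeasure
  have hp0 : 0 ≤ p := by linarith
  have hU := hUV.fst
  have hV := hUV.snd
  -- The regression coefficient: Z = V - aU is uncorrelated with U, hence independent of it by joint
  -- Gaussianity.
  set a := cov[U, V; P] / Var[U; P] with ha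
  have vpos : 0 < Var[U; P] := by linarith
  have ha_le : |a| ≤ 2 * |cov[U, V; P]| := by
    rw [ha, abs_div, abs_of_pos vpos, div_le_iff₀ vpos]
    nlinarith [abs_nonneg cov[U, V; P]]
  let Z : Ω → ℝ := fun ω => V ω - a * U ω
  have hUZ : HasGaussianLaw (fun ω => (U ω, Z ω)) P :=
    hUV.map_fun ((ContinuousLinearMap.fst ℝ ℝ ℝ).prod
      (ContinuousLinearMap.snd ℝ ℝ ℝ - a • ContinuousLinearMap.fst ℝ ℝ ℝ))
  have hZ := hUZ.snd
  have hZ0 : P[Z] = 0 := by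
    change ∫ ω, V ω - a * U ω ∂P = 0
    rw [integral_sub hV.integrable (hU.integrable.const_mul a), integral_const_mul]
    simp [hU0, hV0]
  have mU := hU.memLp_two
  have mV := hV.memLp_two
  have mZ := hZ.memLp_two
  have maU : MemLp (fun ω => a * U ω) 2 P := mU.const_mul a
  have covUZ : cov[U, Z; P] = 0 := by
    change cov[U, fun ω => V ω - a * U ω; P] = 0
    rw [covariance_fun_sub_right mU mV maU, covariance_const_mul_right,
      covariance_self hU.aemeasurable, ha]
    field_simp
    ring
  have hZv : Var[Z; P] ≤ 2 := by
    have hVeq : V = Z + fun ω => a * U ω := by ext ω; simp [Z]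
    have h1 : Var[V; P] = Var[Z; P] + a ^ 2 * Var[U; P] := by
      rw [hVeq, variance_add mZ maU, covariance_const_mul_right, covariance_comm, covUZ,
        variance_const_mul]
      ring
    nlinarith [sq_nonneg a]
  have indep : IndepFun U Z P := hUZ.indepFun_of_covariance_eq_zero covUZ
  have indep' : IndepFun (fun ω => |U ω| ^ p) (fun ω => |Z ω| ^ p) P :=
    indep.comp (φ := fun z => |z| ^ p) (ψ := fun z => |z| ^ p) (by fun_prop) (by fun_prop)
  have pU := memLp_two_abs_rpow_of_hasGaussianLaw hp0 hU
  have pV := memLp_two_abs_rpow_of_hasGaussianLaw hp0 hV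
  have pZ := memLp_two_abs_rpow_of_hasGaussianLaw hp0 hZ
  -- By independence |Z|^p contributes nothing to the covariance with |U|^p, so |V|^p may be
  -- replaced by `D`, which is of size |a|.
  let D : Ω → ℝ := fun ω => |V ω| ^ p - |Z ω| ^ p
  have pD : MemLp D 2 P := pV.sub pZ
  have covD : cov[fun ω => |U ω| ^ p, fun ω => |V ω| ^ p; P]
      = ∫ ω, |U ω| ^ p * D ω ∂P - (∫ ω, |U ω| ^ p ∂P) * ∫ ω, D ω ∂P := by
    have h1 : cov[fun ω => |U ω| ^ p, D; P] = cov[fun ω => |U ω| ^ p, fun ω => |V ω| ^ p; P] := by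
      change cov[fun ω => |U ω| ^ p, fun ω => |V ω| ^ p - |Z ω| ^ p; P] = _
      rw [covariance_fun_sub_right pU pV pZ, indep'.covariance_eq_zero pU pZ, sub_zero]
    rw [← h1, covariance_eq_sub pU pD]
    rfl
  let S : Ω → ℝ := fun ω => |U ω| + |V ω| + |Z ω|
  obtain ⟨iS, bS⟩ := integral_add_add_rpow_le hp0 hU hV hZ hU0 hV0 hZ0 hUu hVu hZv
  obtain ⟨iS2, bS2⟩ := integral_add_add_rpow_le (q := 2 * p) (by positivity)
    hU hV hZ hU0 hV0 hZ0 hUu hVu hZv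
  have S0 : ∀ ω, 0 ≤ S ω := fun ω => by simp only [S]; positivity
  have hUS : ∀ ω, |U ω| ^ p ≤ S ω ^ p := fun ω => by
    refine Real.rpow_le_rpow (abs_nonneg _) ?_ hp0
    simp only [S]; linarith [abs_nonneg (V ω), abs_nonneg (Z ω)]
  have hDS : ∀ ω, |D ω| ≤ p * |a| * S ω ^ p := fun ω => by
    have h1 := abs_rpow_sub_rpow_le (abs_nonneg (V ω)) (abs_nonneg (Z ω)) hp
    have h2 : |(|V ω| - |Z ω|)| ≤ |a| * S ω := by
      refine (abs_abs_sub_abs_le (V ω) (Z ω)).trans ?_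
      have : V ω - Z ω = a * U ω := by simp [Z]
      rw [this, abs_mul]
      gcongr
      simp only [S]; linarith [abs_nonneg (V ω), abs_nonneg (Z ω)]
    have h3 : (|V ω| + |Z ω|) ^ (p - 1) ≤ S ω ^ (p - 1) := by
      refine Real.rpow_le_rpow (by positivity) ?_ (by linarith)
      simp only [S]; linarith [abs_nonneg (U ω)]
    have h4 : S ω ^ (p - 1) * S ω = S ω ^ p := by
      rcases (S0 ω).eq_or_lt with h | h
      · rw [← h, mul_zero, Real.zero_rpow (by linarith)]
      · rw [← Real.rpow_add_one h.ne']; congr 1; ring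
    have sp : 0 ≤ S ω ^ (p - 1) := Real.rpow_nonneg (S0 ω) _
    calc |D ω| ≤ p * (|V ω| + |Z ω|) ^ (p - 1) * |(|V ω| - |Z ω|)| := h1
      _ ≤ p * S ω ^ (p - 1) * (|a| * S ω) := by gcongr
      _ = p * |a| * (S ω ^ (p - 1) * S ω) := by ring
      _ = _ := by rw [h4]
  have hS2 : ∀ ω, S ω ^ p * S ω ^ p = S ω ^ (2 * p) := fun ω => by
    rw [mul_comm 2 p, Real.rpow_mul (S0 ω)]; norm_cast; ring
  have b1 : |∫ ω, |U ω| ^ p * D ω ∂P| ≤ p * |a| * gaussianSumMomentBound (2 * p) := by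
    calc |∫ ω, |U ω| ^ p * D ω ∂P| ≤ ∫ ω, p * |a| * S ω ^ (2 * p) ∂P := by
          refine norm_integral_le_of_norm_le (f := fun ω => |U ω| ^ p * D ω)
            (iS2.const_mul _) (ae_of_all _ fun ω => ?_)
          rw [norm_mul, Real.norm_of_nonneg (by positivity), Real.norm_eq_abs, ← hS2]
          calc |U ω| ^ p * |D ω| ≤ S ω ^ p * (p * |a| * S ω ^ p) := by
                have := Real.rpow_nonneg (S0 ω) p
                exact mul_le_mul (hUS ω) (hDS ω) (abs_nonneg _) this
            _ = _ := by ring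
      _ = p * |a| * ∫ ω, S ω ^ (2 * p) ∂P := integral_const_mul _ _
      _ ≤ _ := by gcongr
  have b2 : |∫ ω, D ω ∂P| ≤ p * |a| * gaussianSumMomentBound p := by
    calc |∫ ω, D ω ∂P| ≤ ∫ ω, p * |a| * S ω ^ p ∂P :=
          norm_integral_le_of_norm_le (f := D) (iS.const_mul _) (ae_of_all _ hDS)
      _ = p * |a| * ∫ ω, S ω ^ p ∂P := integral_const_mul _ _
      _ ≤ _ := by gcongr
  have b3 : |∫ ω, |U ω| ^ p ∂P| ≤ gaussianSumMomentBound p := by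
    rw [abs_of_nonneg (integral_nonneg fun _ => by positivity)]
    exact (integral_mono (integrable_abs_rpow_of_hasGaussianLaw hp0 hU) iS hUS).trans bS
  have M1 := gaussianSumMomentBound_nonneg p
  have M2 := gaussianSumMomentBound_nonneg (2 * p)
  rw [covD]
  calc |∫ ω, |U ω| ^ p * D ω ∂P - (∫ ω, |U ω| ^ p ∂P) * ∫ ω, D ω ∂P|
      ≤ |∫ ω, |U ω| ^ p * D ω ∂P| + |∫ ω, |U ω| ^ p ∂P| * |∫ ω, D ω ∂P| := by
        rw [← abs_mul]; exact abs_sub _ _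
    _ ≤ p * |a| * gaussianSumMomentBound (2 * p)
        + gaussianSumMomentBound p * (p * |a| * gaussianSumMomentBound p) := by gcongr
    _ = p * (gaussianSumMomentBound (2 * p) + gaussianSumMomentBound p ^ 2) * |a| := by ring
    _ ≤ p * (gaussianSumMomentBound (2 * p) + gaussianSumMomentBound p ^ 2)
        * (2 * |cov[U, V; P]|) := by gcongr
    _ = _ := by ring

end Gaussian

/-! ### Variances and covariances of the scaled increments -/

/-- Turns the kernel bounds r^(2γ-2) at the cut-off r = √h into powers of h. -/
lemma sqrt_rpow_eq {h γ : ℝ} (hh : 0 ≤ h) : √h ^ (2 * γ - 2) = h ^ (γ - 1) := by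
  rw [Real.sqrt_eq_rpow, ← Real.rpow_mul hh]; congr 1; ring

lemma rpow_add_rpow_le_two_mul {a b β : ℝ} (ha : 0 ≤ a) (hb : 0 ≤ b) (hβ0 : 0 ≤ β)
    (hβ1 : β ≤ 1) : (a + a) ^ β + (b + b) ^ β ≤ 2 * (a + b) ^ β := by
  have := (Real.concaveOn_rpow hβ0 hβ1).2 (show a + a ∈ Set.Ici 0 from add_nonneg ha ha)
    (show b + b ∈ Set.Ici 0 from add_nonneg hb hb) (by norm_num : (0 : ℝ) ≤ 1 / 2)
    (by norm_num : (0 : ℝ) ≤ 1 / 2) (by norm_num)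
  simp only [smul_eq_mul] at this
  rw [show 1 / 2 * (a + a) + 1 / 2 * (b + b) = a + b by ring] at this
  linarith

/-- Midpoint concavity of u ↦ u^β. It gives the sign for every x ≥ 0, including near 0 where the
derivative bound blows up. -/
lemma mixedDiff_powSum_self_nonpos {α β x h : ℝ} (hβ0 : 0 ≤ β) (hβ1 : β ≤ 1) (hx : 0 ≤ x)
    (hh : 0 ≤ h) : mixedDiff (fun s t => (s ^ (2 * α) + t ^ (2 * α)) ^ β) x x h ≤ 0 := by
  have := rpow_add_rpow_le_two_mul (a := (x + h) ^ (2 * α)) (b := x ^ (2 * α))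
    (by positivity) (by positivity) hβ0 hβ1
  unfold mixedDiff
  beta_reduce
  rw [add_comm (x ^ (2 * α)) ((x + h) ^ (2 * α))]
  linarith

lemma mixedDiff_abs_sub_rpow_self {γ x h : ℝ} (hγ : 0 < γ) (hh : 0 ≤ h) :
    mixedDiff (fun s t => |t - s| ^ (2 * γ)) x x h = -(2 * h ^ (2 * γ)) := by
  have : (2 * γ) ≠ 0 := by positivity
  simp [mixedDiff, Real.zero_rpow this, abs_of_nonneg hh]
  ring

/-- After normalisation by h^(-2γ), a mixed difference of size h^(γ-1)h² is of size h^(1-γ), which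
tends to 0 when γ < 1. -/
lemma inv_rpow_sq_mul_eq {γ h : ℝ} (hh : 0 < h) :
    (h ^ γ)⁻¹ ^ 2 * (h ^ (γ - 1) * h ^ 2) = h ^ (1 - γ) := by
  have e : h ^ 2 = h ^ (2 : ℝ) := by norm_cast
  rw [e, ← Real.rpow_neg hh.le, ← Real.rpow_natCast, ← Real.rpow_mul hh.le,
    ← Real.rpow_add hh, ← Real.rpow_add hh]
  congr 1
  push_cast
  ring

section Increments

variable {Ω : Type*} [MeasurableSpace Ω] {P : Measure Ω} {α β : ℝ} {B : ℝ≥0 → Ω → ℝ}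

/-- The increment of the sample path over `[x, x + h]`, divided by `h ^ γ`. -/
noncomputable def scaledIncrement (B : ℝ≥0 → Ω → ℝ) (γ h x : ℝ) (ω : Ω) : ℝ :=
  (h ^ γ)⁻¹ * (samplePath B ω (x + h) - samplePath B ω x)

namespace IsBifractionalBrownianMotion

lemma isGaussianProcess_samplePath (hB : IsBifractionalBrownianMotion α β B P) :
    IsGaussianProcess (fun t ω => samplePath B ω t) P :=
  hB.isGaussianProcess.comp_right Real.toNNReal

lemma memLp_samplePath (hB : IsBifractionalBrownianMotion α β B P) (t : ℝ) :
    MemLp (fun ω => samplePath B ω t) 2 P := by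
  have := hB.isGaussianProcess.isProbabilityMeasure
  exact (hB.isGaussianProcess_samplePath.hasGaussianLaw_eval t).memLp_two

lemma hasGaussianLaw_scaledIncrement (hB : IsBifractionalBrownianMotion α β B P)
    (γ h x y : ℝ) :
    HasGaussianLaw (fun ω => (scaledIncrement B γ h x ω, scaledIncrement B γ h y ω)) P := by
  have h1 : HasGaussianLaw (fun ω (i : Fin 4) =>
      samplePath B ω (![x + h, x, y + h, y] i)) P := by
    classical
    -- The four times may coincide, so the Gaussian law is taken on the finite set of their values
    -- and pulled back to the index set.
    let t : Fin 4 → ℝ := ![x + h, x, y + h, y]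
    let L : ((Finset.univ.image t) → ℝ) →L[ℝ] (Fin 4 → ℝ) :=
      ContinuousLinearMap.pi fun i => ContinuousLinearMap.proj ⟨t i, by simp⟩
    exact (hB.isGaussianProcess_samplePath.hasGaussianLaw (Finset.univ.image t)).map_fun L
  have h2 := h1.map_fun
    ((((h ^ γ)⁻¹ : ℝ) • ((ContinuousLinearMap.proj (R := ℝ) (φ := fun _ : Fin 4 => ℝ) 0)
      - ContinuousLinearMap.proj 1)).prod
     (((h ^ γ)⁻¹ : ℝ) • ((ContinuousLinearMap.proj (R := ℝ) (φ := fun _ : Fin 4 => ℝ) 2)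
      - ContinuousLinearMap.proj 3)))
  exact h2

lemma integral_scaledIncrement (hB : IsBifractionalBrownianMotion α β B P) (γ h x : ℝ) :
    P[scaledIncrement B γ h x] = 0 := by
  have := hB.isGaussianProcess.isProbabilityMeasure
  have hi : ∀ t, Integrable (fun ω => samplePath B ω t) P := fun t =>
    (hB.isGaussianProcess_samplePath.hasGaussianLaw_eval t).integrable
  have hz : ∀ t, ∫ ω, samplePath B ω t ∂P = 0 := fun t => hB.centered t.toNNReal
  simp only [scaledIncrement]
  rw [integral_const_mul, integral_sub (hi _) (hi _), hz, hz]
  simp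

lemma covariance_samplePath (hB : IsBifractionalBrownianMotion α β B P) {s t : ℝ}
    (hs : 0 ≤ s) (ht : 0 ≤ t) :
    cov[fun ω => samplePath B ω s, fun ω => samplePath B ω t; P]
      = 1 / 2 ^ β * ((s ^ (2 * α) + t ^ (2 * α)) ^ β - |t - s| ^ (2 * (α * β))) := by
  have := hB.covariance_eq s.toNNReal t.toNNReal
  simp only [bbmCovariance, Real.coe_toNNReal _ hs, Real.coe_toNNReal _ ht] at this
  rw [add_comm (s ^ (2 * α)), ← mul_assoc 2 α β]
  exact this

lemma covariance_scaledIncrement (hB : IsBifractionalBrownianMotion α β B P) {x y h : ℝ}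
    (γ : ℝ) (hx : 0 ≤ x) (hy : 0 ≤ y) (hh : 0 ≤ h) :
    cov[scaledIncrement B γ h x, scaledIncrement B γ h y; P]
      = (h ^ γ)⁻¹ ^ 2 * (1 / 2 ^ β *
        (mixedDiff (fun s t => (s ^ (2 * α) + t ^ (2 * α)) ^ β) x y h
          - mixedDiff (fun s t => |t - s| ^ (2 * (α * β))) x y h)) := by
  have := hB.isGaussianProcess.isProbabilityMeasure
  have m := hB.memLp_samplePath
  unfold scaledIncrement
  rw [covariance_const_mul_left, covariance_const_mul_right,
    covariance_fun_sub_fun_sub (m _) (m _) (m _) (m _),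
    hB.covariance_samplePath (add_nonneg hx hh) (add_nonneg hy hh),
    hB.covariance_samplePath (add_nonneg hx hh) hy,
    hB.covariance_samplePath hx (add_nonneg hy hh),
    hB.covariance_samplePath hx hy]
  unfold mixedDiff
  ring

/-- The summand 2 is the diagonal mixed difference of |t - s|^(2γ), with its sign reversed and
scaled by h^(-2γ). -/
lemma variance_scaledIncrement (hB : IsBifractionalBrownianMotion α β B P) {x h : ℝ}
    (hγ : 0 < α * β) (hx : 0 ≤ x) (hh : 0 < h) :
    Var[scaledIncrement B (α * β) h x; P]
      = 1 / 2 ^ β * ((h ^ (α * β))⁻¹ ^ 2 *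
        mixedDiff (fun s t => (s ^ (2 * α) + t ^ (2 * α)) ^ β) x x h + 2) := by
  have hm := (hB.hasGaussianLaw_scaledIncrement (α * β) h x x).fst.aemeasurable
  rw [← covariance_self hm, hB.covariance_scaledIncrement _ hx hx hh.le,
    mixedDiff_abs_sub_rpow_self hγ hh.le]
  have e : h ^ (2 * (α * β)) = (h ^ (α * β)) ^ 2 := by
    rw [mul_comm, Real.rpow_mul hh.le]; norm_cast
  have : 0 < h ^ (α * β) := by positivity
  rw [e]
  field_simp
  ring

lemma variance_scaledIncrement_le (hB : IsBifractionalBrownianMotion α β B P) {x h : ℝ}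
    (hα0 : 0 < α) (hβ0 : 0 < β) (hβ1 : β ≤ 1) (hx : 0 ≤ x) (hh : 0 < h) :
    Var[scaledIncrement B (α * β) h x; P] ≤ 2 := by
  rw [hB.variance_scaledIncrement (by positivity) hx hh]
  have h1 := mixedDiff_powSum_self_nonpos (α := α) hβ0.le hβ1 hx hh.le
  have h2 : (1 : ℝ) ≤ 2 ^ β := Real.one_le_rpow (by norm_num) hβ0.le
  have h3 := mul_nonpos_of_nonneg_of_nonpos (sq_nonneg (h ^ (α * β))⁻¹) h1
  rw [one_div, inv_mul_le_iff₀ (by linarith)]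
  linarith

/-- For x ≥ √h the power-sum kernel contributes at least -4h^(1-γ) ≥ -1, so the bracket is at least
1; the prefactor 2^(-β) is at least 1/2. -/
lemma le_variance_scaledIncrement (hB : IsBifractionalBrownianMotion α β B P) {x h : ℝ}
    (hα0 : 0 < α) (hα1 : α < 1) (hβ0 : 0 < β) (hβ1 : β ≤ 1) (hx : √h ≤ x) (hh : 0 < h)
    (hsmall : h ^ (1 - α * β) ≤ 1 / 4) :
    1 / 2 ≤ Var[scaledIncrement B (α * β) h x; P] := by
  have sp : 0 < √h := Real.sqrt_pos.2 hh
  rw [hB.variance_scaledIncrement (by positivity) (sp.le.trans hx) hh]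
  have h1 := abs_mixedDiff_powSum_le hα0 hα1 hβ0 hβ1 sp hx hx hh.le
  rw [sqrt_rpow_eq hh.le] at h1
  have h2 : (2 : ℝ) ^ β ≤ 2 := by
    simpa using Real.rpow_le_rpow_of_exponent_le (by norm_num : (1 : ℝ) ≤ 2) hβ1
  have h2' : (0 : ℝ) < 2 ^ β := by positivity
  have h3 := mul_le_mul_of_nonneg_left (abs_le.1 h1).1 (sq_nonneg (h ^ (α * β))⁻¹)
  have h4 := inv_rpow_sq_mul_eq (γ := α * β) hh
  rw [one_div_mul_eq_div, le_div_iff₀ h2']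
  have h5 : (h ^ (α * β))⁻¹ ^ 2 * -(4 * h ^ (α * β - 1) * h ^ 2) = -(4 * h ^ (1 - α * β)) := by
    rw [← h4]; ring
  linarith

lemma abs_covariance_scaledIncrement_le (hB : IsBifractionalBrownianMotion α β B P)
    {x y h : ℝ} (hα0 : 0 < α) (hα1 : α < 1) (hβ0 : 0 < β) (hβ1 : β ≤ 1) (hx : √h ≤ x)
    (hy : √h ≤ y) (hxy : √h ≤ |x - y|) (hh : 0 < h) (hsmall : h ≤ 1 / 4) :
    |cov[scaledIncrement B (α * β) h x, scaledIncrement B (α * β) h y; P]|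
      ≤ 12 * h ^ (1 - α * β) := by
  wlog hle : x ≤ y generalizing x y
  · rw [covariance_comm]
    exact this hy hx (by rwa [abs_sub_comm]) (le_of_not_ge hle)
  have sp : 0 < √h := Real.sqrt_pos.2 hh
  have hγ1 : α * β < 1 := by nlinarith
  have sq : √h * √h = h := Real.mul_self_sqrt hh.le
  have sle : √h ≤ 1 / 2 := by nlinarith
  rw [abs_sub_comm, abs_of_nonneg (by linarith)] at hxy
  rw [hB.covariance_scaledIncrement _ (sp.le.trans hx) (sp.le.trans hy) hh.le]
  have h1 := abs_mixedDiff_powSum_le hα0 hα1 hβ0 hβ1 sp hx hy hh.le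
  -- As h ≤ 1/4 gives h ≤ √h/2, a separation of √h leaves a gap of √h/2 between the two intervals.
  have h2 := abs_mixedDiff_abs_sub_rpow_le (γ := α * β) (x := x) (y := y) (h := h) (r := √h / 2)
    (by positivity) hγ1 (by positivity) (by nlinarith) hh.le
  have h3 : (√h / 2) ^ (2 * (α * β) - 2) ≤ 4 * h ^ (α * β - 1) := by
    rw [Real.div_rpow sp.le (by norm_num), sqrt_rpow_eq hh.le, div_le_iff₀ (by positivity)]
    have : (1 / 4 : ℝ) ≤ 2 ^ (2 * (α * β) - 2) := by
      calc (1 / 4 : ℝ) = 2 ^ (-2 : ℝ) := by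
            rw [Real.rpow_neg (by norm_num)]; norm_num
        _ ≤ _ := Real.rpow_le_rpow_of_exponent_le (by norm_num) (by nlinarith)
    have h0 : 0 ≤ h ^ (α * β - 1) := by positivity
    nlinarith
  rw [sqrt_rpow_eq hh.le] at h1
  set m₁ := mixedDiff (fun s t => (s ^ (2 * α) + t ^ (2 * α)) ^ β) x y h
  set m₂ := mixedDiff (fun s t => |t - s| ^ (2 * (α * β))) x y h
  -- 12 = 4 + 2·4: the power-sum kernel, and the diagonal kernel with the factor 4 lost by halving
  -- the gap.
  have hm : |m₁ - m₂| ≤ 12 * (h ^ (α * β - 1) * h ^ 2) := by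
    have : 2 * (√h / 2) ^ (2 * (α * β) - 2) * h ^ 2 ≤ 2 * (4 * h ^ (α * β - 1)) * h ^ 2 := by
      gcongr
    have := abs_sub m₁ m₂
    linarith
  have h4 : |1 / (2 : ℝ) ^ β| ≤ 1 := by
    rw [abs_of_pos (by positivity), div_le_one (by positivity)]
    exact Real.one_le_rpow (by norm_num) hβ0.le
  rw [abs_mul, abs_of_nonneg (sq_nonneg _), abs_mul]
  calc (h ^ (α * β))⁻¹ ^ 2 * (|1 / (2 : ℝ) ^ β| * |m₁ - m₂|)
      ≤ (h ^ (α * β))⁻¹ ^ 2 * (1 * (12 * (h ^ (α * β - 1) * h ^ 2))) := by gcongr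
    _ = 12 * h ^ (1 - α * β) := by rw [← inv_rpow_sq_mul_eq (γ := α * β) hh]; ring

end IsBifractionalBrownianMotion

end Increments

/-! ### Measurable versions, second moments and almost sure convergence -/

section General

variable {Ω : Type*} [MeasurableSpace Ω] {P : Measure Ω}

/-- A process which is almost surely continuous on `[0, 1]` agrees there, outside a null set,
with a jointly measurable process all of whose paths are continuous. -/
lemma exists_measurable_continuous_version {W : ℝ → Ω → ℝ} (hm : ∀ t, AEMeasurable (W t) P)
    (hc : ∀ᵐ ω ∂P, ContinuousOn (fun t => W t ω) (Set.Icc 0 1)) :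
    ∃ Z : ℝ → Ω → ℝ, Measurable (Function.uncurry Z) ∧ (∀ ω, Continuous fun t => Z t ω) ∧
      ∀ᵐ ω ∂P, ∀ t ∈ Set.Icc (0 : ℝ) 1, Z t ω = W t ω := by
  classical
  let d : ℕ → Set.Icc (0 : ℝ) 1 := TopologicalSpace.denseSeq _
  have hd : DenseRange d := TopologicalSpace.denseRange_denseSeq _
  have hae : ∀ᵐ ω ∂P, ContinuousOn (fun t => W t ω) (Set.Icc 0 1) ∧
      ∀ n, W (d n) ω = (hm (d n)).mk _ ω :=
    hc.and (ae_all_iff.2 fun n => (hm (d n)).ae_eq_mk)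
  let N := toMeasurable P {ω | ¬ (ContinuousOn (fun t => W t ω) (Set.Icc 0 1) ∧
      ∀ n, W (d n) ω = (hm (d n)).mk _ ω)}
  have hN : MeasurableSet N := measurableSet_toMeasurable _ _
  have hN0 : P N = 0 := by rw [measure_toMeasurable]; exact hae
  have hgood : ∀ ω ∉ N, ContinuousOn (fun t => W t ω) (Set.Icc 0 1) ∧
      ∀ n, W (d n) ω = (hm (d n)).mk _ ω := fun ω hω => by
    by_contra h
    exact hω (subset_toMeasurable _ _ h)
  let Y : Set.Icc (0 : ℝ) 1 → Ω → ℝ := fun t ω => if ω ∈ N then 0 else W t ω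
  have hYc : ∀ ω, Continuous fun t => Y t ω := fun ω => by
    by_cases hω : ω ∈ N
    · simpa [Y, hω] using continuous_const
    · have e : (fun t => Y t ω) = (Set.Icc (0 : ℝ) 1).domRestrict fun t => W t ω := by
        ext t; simp [Y, hω]
      rw [e]
      exact continuousOn_iff_continuous_domRestrict.1 (hgood ω hω).1
  have hYd : ∀ n, Measurable (Y (d n)) := fun n => by
    have : Y (d n) = fun ω => if ω ∈ N then 0 else (hm (d n)).mk _ ω := by
      ext ω
      by_cases hω : ω ∈ N
      · simp [Y, hω]
      · simp [Y, hω, (hgood ω hω).2 n]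
    rw [this]
    exact Measurable.ite hN measurable_const (hm (d n)).measurable_mk
  -- By path continuity, each evaluation is a pointwise limit of evaluations at the dense times.
  have hYm : ∀ t, Measurable (Y t) := fun t => by
    obtain ⟨u, hu, hlim⟩ := mem_closure_iff_seq_limit.1 (hd t)
    refine measurable_of_tendsto_metrizable (f := fun n => Y (u n)) (fun n => ?_)
      (tendsto_pi_nhds.2 fun ω => ((hYc ω).tendsto t).comp hlim)
    obtain ⟨k, hk⟩ := hu n
    rw [← hk]
    exact hYd k
  refine ⟨fun t => Y (Set.projIcc 0 1 zero_le_one t), ?_, fun ω => ?_, ?_⟩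
  · exact measurable_uncurry_of_continuous_of_measurable
      (fun ω => (hYc ω).comp continuous_projIcc) fun t => hYm _
  · exact (hYc ω).comp continuous_projIcc
  · have : ∀ᵐ ω ∂P, ω ∉ N := measure_eq_zero_iff_ae_notMem.1 hN0
    filter_upwards [this] with ω hω t ht
    simp [Y, hω, Set.projIcc_of_mem zero_le_one ht]

/-- The second moment of the integral of a random field is the double integral of its
second moment function. -/
lemma integral_sq_integral_le {X : Type*} [MeasurableSpace X] {μ : Measure X}
    [IsFiniteMeasure μ] [IsFiniteMeasure P] {g : X → Ω → ℝ}
    (hg : Measurable (Function.uncurry g)) {M : ℝ} {K : X × X → ℝ}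
    (hM : ∀ᵐ x ∂μ, Integrable (fun ω => g x ω ^ 2) P ∧ ∫ ω, g x ω ^ 2 ∂P ≤ M)
    (hKi : Integrable K (μ.prod μ))
    (hK : ∀ᵐ z ∂μ.prod μ, |∫ ω, g z.1 ω * g z.2 ω ∂P| ≤ K z) :
    Integrable (fun ω => (∫ x, g x ω ∂μ) ^ 2) P ∧
      ∫ ω, (∫ x, g x ω ∂μ) ^ 2 ∂P ≤ ∫ z, K z ∂μ.prod μ := by
  have hgx : ∀ x, Measurable (g x) := fun x => hg.comp measurable_prodMk_left
  have hGm : Measurable fun q : (X × X) × Ω => g q.1.1 q.2 * g q.1.2 q.2 := by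
    have h1 : Measurable fun q : (X × X) × Ω => g q.1.1 q.2 :=
      hg.comp ((measurable_fst.comp measurable_fst).prodMk measurable_snd)
    have h2 : Measurable fun q : (X × X) × Ω => g q.1.2 q.2 :=
      hg.comp ((measurable_snd.comp measurable_fst).prodMk measurable_snd)
    exact h1.mul h2
  have hM2 : ∀ᵐ z ∂μ.prod μ, (Integrable (fun ω => g z.1 ω ^ 2) P ∧ ∫ ω, g z.1 ω ^ 2 ∂P ≤ M) ∧
      (Integrable (fun ω => g z.2 ω ^ 2) P ∧ ∫ ω, g z.2 ω ^ 2 ∂P ≤ M) :=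
    (Measure.quasiMeasurePreserving_fst.ae hM).and (Measure.quasiMeasurePreserving_snd.ae hM)
  have hbound : ∀ a b : ℝ, ‖a * b‖ ≤ a ^ 2 + b ^ 2 := fun a b => by
    rw [Real.norm_eq_abs, abs_le]
    constructor <;> nlinarith [sq_nonneg (a - b), sq_nonneg (a + b)]
  have hint : ∀ᵐ z ∂μ.prod μ, Integrable (fun ω => g z.1 ω * g z.2 ω) P := by
    filter_upwards [hM2] with z hz
    exact (hz.1.1.add hz.2.1).mono' ((hgx _).mul (hgx _)).aestronglyMeasurable
      (ae_of_all _ fun ω => hbound _ _)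
  have hGi : Integrable (fun q : (X × X) × Ω => g q.1.1 q.2 * g q.1.2 q.2)
      ((μ.prod μ).prod P) := by
    rw [integrable_prod_iff hGm.aestronglyMeasurable]
    refine ⟨hint, ?_⟩
    refine (integrable_const (M + M)).mono'
      (hGm.norm.stronglyMeasurable.integral_prod_right').aestronglyMeasurable ?_
    filter_upwards [hM2, hint] with z hz hi
    rw [Real.norm_of_nonneg (integral_nonneg fun _ => norm_nonneg _)]
    calc ∫ ω, ‖g z.1 ω * g z.2 ω‖ ∂P ≤ ∫ ω, (g z.1 ω ^ 2 + g z.2 ω ^ 2) ∂P :=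
          integral_mono hi.norm (hz.1.1.add hz.2.1) fun ω => hbound _ _
      _ = ∫ ω, g z.1 ω ^ 2 ∂P + ∫ ω, g z.2 ω ^ 2 ∂P := integral_add hz.1.1 hz.2.1
      _ ≤ M + M := add_le_add hz.1.2 hz.2.2
  -- `integral_prod_mul` needs no integrability, so this holds for every ω.
  have hsq : ∀ ω, (∫ x, g x ω ∂μ) ^ 2 = ∫ z, g z.1 ω * g z.2 ω ∂μ.prod μ := fun ω => by
    rw [integral_prod_mul (fun x => g x ω) (fun x => g x ω), sq]
  simp_rw [hsq]
  refine ⟨hGi.integral_prod_right, ?_⟩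
  have hswap := integral_integral_swap (f := fun (z : X × X) ω => g z.1 ω * g z.2 ω) hGi
  rw [← hswap]
  have hnorm := norm_integral_le_of_norm_le
    (f := fun z : X × X => ∫ ω, g z.1 ω * g z.2 ω ∂P) hKi hK
  exact (le_abs_self _).trans hnorm

/-- By Tonelli the sum of the squares has finite expectation, hence is almost surely finite, and its
terms tend to 0. -/
lemma ae_tendsto_zero_of_summable_integral_sq {Y : ℕ → Ω → ℝ} {a : ℕ → ℝ}
    (hi : ∀ᶠ n in atTop, Integrable (fun ω => Y n ω ^ 2) P ∧ ∫ ω, Y n ω ^ 2 ∂P ≤ a n)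
    (ha : Summable a) : ∀ᵐ ω ∂P, Tendsto (fun n => Y n ω) atTop (𝓝 0) := by
  obtain ⟨N, hN⟩ := eventually_atTop.1 hi
  have hN' : ∀ n, Integrable (fun ω => Y (n + N) ω ^ 2) P ∧
      ∫ ω, Y (n + N) ω ^ 2 ∂P ≤ a (n + N) := fun n => hN _ (Nat.le_add_left _ _)
  have ha' : Summable fun n => a (n + N) := (summable_nat_add_iff N).2 ha
  have hmeas : ∀ n, AEMeasurable (fun ω => ENNReal.ofReal (Y (n + N) ω ^ 2)) P := fun n =>
    (hN' n).1.aemeasurable.ennreal_ofReal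
  have hfin : ∫⁻ ω, ∑' n, ENNReal.ofReal (Y (n + N) ω ^ 2) ∂P ≠ ∞ := by
    rw [lintegral_tsum hmeas]
    have hle : ∑' n, ∫⁻ ω, ENNReal.ofReal (Y (n + N) ω ^ 2) ∂P
        ≤ ∑' n, ENNReal.ofReal (a (n + N)) := by
      refine ENNReal.tsum_le_tsum fun n => ?_
      rw [← ofReal_integral_eq_lintegral_ofReal (hN' n).1 (ae_of_all _ fun _ => sq_nonneg _)]
      exact ENNReal.ofReal_le_ofReal (hN' n).2
    exact ne_top_of_le_ne_top ha'.tsum_ofReal_ne_top hle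
  filter_upwards [ae_lt_top' (AEMeasurable.tsum hmeas) hfin] with ω hω
  have h1 := ENNReal.tendsto_atTop_zero_of_tsum_ne_top hω.ne
  have h2 : Tendsto (fun n => Y (n + N) ω ^ 2) atTop (𝓝 0) := by
    have := (ENNReal.tendsto_toReal ENNReal.zero_ne_top).comp h1
    simpa [Function.comp_def, ENNReal.toReal_ofReal (sq_nonneg _)] using this
  have h3 : Tendsto (fun n => |Y (n + N) ω|) atTop (𝓝 0) := by
    have := (Real.continuous_sqrt.tendsto 0).comp h2
    simpa [Function.comp_def, Real.sqrt_sq_eq_abs] using this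
  exact (tendsto_add_atTop_iff_nat N).1 ((tendsto_zero_iff_abs_tendsto_zero _).2 h3)

end General

/-! ### Concentration of the increment energy -/

/-- The pairs of points with a coordinate below `r` or at distance less than `r`. -/
def nearSet (r : ℝ) : Set (ℝ × ℝ) := {z | z.1 < r ∨ z.2 < r ∨ |z.1 - z.2| < r}

lemma measurableSet_nearSet (r : ℝ) : MeasurableSet (nearSet r) := by
  have h : nearSet r = {z : ℝ × ℝ | z.1 < r} ∪ ({z | z.2 < r} ∪ {z | |z.1 - z.2| < r}) := by
    ext z; simp [nearSet]
  rw [h]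
  exact (measurableSet_lt (by fun_prop) (by fun_prop)).union
    ((measurableSet_lt (by fun_prop) (by fun_prop)).union
      (measurableSet_lt (by fun_prop) (by fun_prop)))

/-- 4r = r + r + 2r: two strips along the axes and a band around the diagonal. -/
lemma measure_nearSet_le {b r : ℝ} (hb : b ≤ 1) (hr : 0 ≤ r) :
    ((volume.restrict (Set.Icc 0 b)).prod (volume.restrict (Set.Icc 0 b))) (nearSet r)
      ≤ ENNReal.ofReal (4 * r) := by
  set μ := volume.restrict (Set.Icc (0 : ℝ) b) with hμ
  have hμ1 : μ Set.univ ≤ 1 := by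
    rw [hμ, Measure.restrict_apply_univ, Real.volume_Icc]
    exact ENNReal.ofReal_le_one.2 (by linarith)
  have hμr : μ (Set.Iio r) ≤ ENNReal.ofReal r := by
    rw [hμ, Measure.restrict_apply measurableSet_Iio]
    calc volume (Set.Iio r ∩ Set.Icc 0 b) ≤ volume (Set.Icc 0 r) :=
          measure_mono fun x hx => ⟨hx.2.1, hx.1.le⟩
      _ = ENNReal.ofReal r := by rw [Real.volume_Icc, sub_zero]
  have h1 : (μ.prod μ) (Set.Iio r ×ˢ Set.univ) ≤ ENNReal.ofReal r := by
    rw [Measure.prod_prod]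
    calc μ (Set.Iio r) * μ Set.univ ≤ ENNReal.ofReal r * 1 := by gcongr
      _ = _ := mul_one _
  have h2 : (μ.prod μ) (Set.univ ×ˢ Set.Iio r) ≤ ENNReal.ofReal r := by
    rw [Measure.prod_prod]
    calc μ Set.univ * μ (Set.Iio r) ≤ 1 * ENNReal.ofReal r := by gcongr
      _ = _ := one_mul _
  have h3 : (μ.prod μ) {z | |z.1 - z.2| < r} ≤ ENNReal.ofReal (2 * r) := by
    rw [Measure.prod_apply (measurableSet_lt (by fun_prop) (by fun_prop))]
    calc ∫⁻ x, μ (Prod.mk x ⁻¹' {z : ℝ × ℝ | |z.1 - z.2| < r}) ∂μ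
        ≤ ∫⁻ _, ENNReal.ofReal (2 * r) ∂μ := by
          refine lintegral_mono fun x => ?_
          calc μ (Prod.mk x ⁻¹' {z : ℝ × ℝ | |z.1 - z.2| < r})
              ≤ volume (Prod.mk x ⁻¹' {z : ℝ × ℝ | |z.1 - z.2| < r}) :=
                Measure.restrict_apply_le _ _
            _ ≤ volume (Metric.ball x r) := by
                refine measure_mono fun y hy => ?_
                rw [Metric.mem_ball, Real.dist_eq, abs_sub_comm]
                exact hy
            _ = ENNReal.ofReal (2 * r) := Real.volume_ball x r
      _ = ENNReal.ofReal (2 * r) * μ Set.univ := lintegral_const _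
      _ ≤ ENNReal.ofReal (2 * r) * 1 := by gcongr
      _ = _ := mul_one _
  have hsub : nearSet r ⊆ (Set.Iio r ×ˢ Set.univ) ∪ ((Set.univ ×ˢ Set.Iio r) ∪
      {z | |z.1 - z.2| < r}) := fun z hz => by
    simpa [nearSet] using hz
  calc (μ.prod μ) (nearSet r) ≤ ENNReal.ofReal r + (ENNReal.ofReal r + ENNReal.ofReal (2 * r)) :=
        (measure_mono hsub).trans ((measure_union_le _ _).trans
          (add_le_add h1 ((measure_union_le _ _).trans (add_le_add h2 h3))))
    _ = ENNReal.ofReal (4 * r) := by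
        rw [← ENNReal.ofReal_add hr (by positivity), ← ENNReal.ofReal_add hr (by positivity)]
        congr 1; ring

/-- The `p`-th power of the `L^p([0, 1 - h])` norm of `x ↦ h ^ (-γ) (f (x + h) - f x)`. -/
noncomputable def incrementEnergy (γ p h : ℝ) (f : ℝ → ℝ) : ℝ :=
  ∫ x in Set.Icc 0 (1 - h), |(h ^ γ)⁻¹ * (f (x + h) - f x)| ^ p

/-- The expected increment energy of the sample path. -/
noncomputable def meanIncrementEnergy {Ω : Type*} [MeasurableSpace Ω] (B : ℝ≥0 → Ω → ℝ) (P : Measure Ω)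
    (γ p h : ℝ) : ℝ :=
  ∫ x in Set.Icc 0 (1 - h), ∫ ω, |scaledIncrement B γ h x ω| ^ p ∂P

namespace IsBifractionalBrownianMotion

variable {Ω : Type*} [MeasurableSpace Ω] {P : Measure Ω} {α β p h : ℝ} {B : ℝ≥0 → Ω → ℝ}
  {Z : ℝ → Ω → ℝ}

lemma ae_scaledIncrement_eq (hZB : ∀ᵐ ω ∂P, ∀ t ∈ Set.Icc (0 : ℝ) 1, Z t ω = samplePath B ω t)
    (γ : ℝ) {x : ℝ} (hh : 0 < h) (hx : x ∈ Set.Icc 0 (1 - h)) :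
    (fun ω => |(h ^ γ)⁻¹ * (Z (x + h) ω - Z x ω)| ^ p)
      =ᵐ[P] fun ω => |scaledIncrement B γ h x ω| ^ p := by
  filter_upwards [hZB] with ω hω
  rw [scaledIncrement, hω x ⟨hx.1, by linarith [hx.2]⟩,
    hω (x + h) ⟨by linarith [hx.1], by linarith [hx.2]⟩]

lemma measurable_integral_incrementPower [SFinite P] (hZ : Measurable (Function.uncurry Z))
    (γ p h : ℝ) :
    Measurable (fun q : ℝ × Ω => |(h ^ γ)⁻¹ * (Z (q.1 + h) q.2 - Z q.1 q.2)| ^ p) ∧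
    Measurable (fun x => ∫ ω, |(h ^ γ)⁻¹ * (Z (x + h) ω - Z x ω)| ^ p ∂P) := by
  have h1 : Measurable fun q : ℝ × Ω => Z (q.1 + h) q.2 :=
    hZ.comp ((measurable_fst.add_const h).prodMk measurable_snd)
  have h2 : Measurable fun q : ℝ × Ω => Z q.1 q.2 := hZ
  have hF : Measurable fun q : ℝ × Ω => |(h ^ γ)⁻¹ * (Z (q.1 + h) q.2 - Z q.1 q.2)| ^ p := by
    fun_prop
  exact ⟨hF, (hF.stronglyMeasurable.integral_prod_right').measurable⟩

/-- Joint measurability is known only for `Z`, so measurability in x of the mean is transferred from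
there. -/
lemma integrableOn_mean (hB : IsBifractionalBrownianMotion α β B P)
    (hα0 : 0 < α) (hβ0 : 0 < β) (hβ1 : β ≤ 1) (hp : 1 ≤ p) (hh : 0 < h)
    (hZ : Measurable (Function.uncurry Z))
    (hZB : ∀ᵐ ω ∂P, ∀ t ∈ Set.Icc (0 : ℝ) 1, Z t ω = samplePath B ω t) :
    IntegrableOn (fun x => ∫ ω, |scaledIncrement B (α * β) h x ω| ^ p ∂P)
      (Set.Icc 0 (1 - h)) := by
  have := hB.isGaussianProcess.isProbabilityMeasure
  have hm := (measurable_integral_incrementPower (P := P) hZ (α * β) p h).2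
  have heq : ∀ x ∈ Set.Icc 0 (1 - h), ∫ ω, |(h ^ (α * β))⁻¹ * (Z (x + h) ω - Z x ω)| ^ p ∂P
      = ∫ ω, |scaledIncrement B (α * β) h x ω| ^ p ∂P := fun x hx =>
    integral_congr_ae (ae_scaledIncrement_eq hZB _ hh hx)
  refine IntegrableOn.congr_fun ?_ heq measurableSet_Icc
  refine Measure.integrableOn_of_bounded (M := √2 ^ p * gaussianAbsMoment p)
    (by simp) hm.aestronglyMeasurable ?_
  filter_upwards [ae_restrict_mem measurableSet_Icc] with x hx
  rw [heq x hx, Real.norm_of_nonneg (integral_nonneg fun _ => by positivity)]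
  exact integral_abs_rpow_le_of_hasGaussianLaw (by linarith)
    (hB.hasGaussianLaw_scaledIncrement _ h x x).fst (hB.integral_scaledIncrement _ h x)
    (hB.variance_scaledIncrement_le hα0 hβ0 hβ1 hx.1 hh)

lemma meanIncrementEnergy_le (hB : IsBifractionalBrownianMotion α β B P)
    (hα0 : 0 < α) (hβ0 : 0 < β) (hβ1 : β ≤ 1) (hp : 1 ≤ p) (hh : 0 < h) (hh1 : h ≤ 1)
    (hZ : Measurable (Function.uncurry Z))
    (hZB : ∀ᵐ ω ∂P, ∀ t ∈ Set.Icc (0 : ℝ) 1, Z t ω = samplePath B ω t) :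
    meanIncrementEnergy B P (α * β) p h ≤ √2 ^ p * gaussianAbsMoment p := by
  have hi := hB.integrableOn_mean hα0 hβ0 hβ1 hp hh hZ hZB
  have hb : 0 ≤ √2 ^ p * gaussianAbsMoment p :=
    mul_nonneg (by positivity) (gaussianAbsMoment_nonneg p)
  calc meanIncrementEnergy B P (α * β) p h
      ≤ ∫ _ in Set.Icc 0 (1 - h), √2 ^ p * gaussianAbsMoment p := by
        refine setIntegral_mono_on hi (integrable_const _) measurableSet_Icc fun x hx => ?_
        exact integral_abs_rpow_le_of_hasGaussianLaw (by linarith)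
          (hB.hasGaussianLaw_scaledIncrement _ h x x).fst (hB.integral_scaledIncrement _ h x)
          (hB.variance_scaledIncrement_le hα0 hβ0 hβ1 hx.1 hh)
    _ = (1 - h) * (√2 ^ p * gaussianAbsMoment p) := by
        rw [setIntegral_const, Measure.real, Real.volume_Icc, sub_zero,
          ENNReal.toReal_ofReal (by linarith), smul_eq_mul]
    _ ≤ _ := mul_le_of_le_one_left hb (by linarith)

/-- The variance is bounded below only for x ≥ √h; discarding x < √h leaves length 1 - h - √h ≥ 1/4.
-/
lemma le_meanIncrementEnergy (hB : IsBifractionalBrownianMotion α β B P)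
    (hα0 : 0 < α) (hα1 : α < 1) (hβ0 : 0 < β) (hβ1 : β ≤ 1) (hp : 1 ≤ p) (hh : 0 < h)
    (hh4 : h ≤ 1 / 4) (hsmall : h ^ (1 - α * β) ≤ 1 / 4)
    (hZ : Measurable (Function.uncurry Z))
    (hZB : ∀ᵐ ω ∂P, ∀ t ∈ Set.Icc (0 : ℝ) 1, Z t ω = samplePath B ω t) :
    1 / 4 * (√(1 / 2) ^ p * gaussianAbsMoment p) ≤ meanIncrementEnergy B P (α * β) p h := by
  have hi := hB.integrableOn_mean hα0 hβ0 hβ1 hp hh hZ hZB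
  have hb : 0 ≤ √(1 / 2) ^ p * gaussianAbsMoment p :=
    mul_nonneg (by positivity) (gaussianAbsMoment_nonneg p)
  have sq : √h * √h = h := Real.mul_self_sqrt hh.le
  have s0 : 0 ≤ √h := Real.sqrt_nonneg h
  have sle : √h ≤ 1 / 2 := by nlinarith
  have hsub : Set.Icc (√h) (1 - h) ⊆ Set.Icc 0 (1 - h) := Set.Icc_subset_Icc_left s0
  calc 1 / 4 * (√(1 / 2) ^ p * gaussianAbsMoment p)
      ≤ (1 - h - √h) * (√(1 / 2) ^ p * gaussianAbsMoment p) := by gcongr; linarith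
    _ = ∫ _ in Set.Icc (√h) (1 - h), √(1 / 2) ^ p * gaussianAbsMoment p := by
        rw [setIntegral_const, Measure.real, Real.volume_Icc,
          ENNReal.toReal_ofReal (by linarith), smul_eq_mul]
    _ ≤ ∫ x in Set.Icc (√h) (1 - h), ∫ ω, |scaledIncrement B (α * β) h x ω| ^ p ∂P := by
        refine setIntegral_mono_on (integrable_const _) (hi.mono_set hsub) measurableSet_Icc fun x hx => ?_
        exact le_integral_abs_rpow_of_hasGaussianLaw (by linarith)
          (hB.hasGaussianLaw_scaledIncrement _ h x x).fst (hB.integral_scaledIncrement _ h x)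
          (hB.le_variance_scaledIncrement hα0 hα1 hβ0 hβ1 hx.1 hh hsmall)
    _ ≤ _ := setIntegral_mono_set hi
        (ae_of_all _ fun x => integral_nonneg fun _ => by positivity) hsub.eventuallyLE

/-- The increment energy concentrates around its mean. -/
lemma integral_sq_incrementEnergy_sub_le (hB : IsBifractionalBrownianMotion α β B P)
    (hα0 : 0 < α) (hα1 : α < 1) (hβ0 : 0 < β) (hβ1 : β ≤ 1) (hp : 1 ≤ p) (hh : 0 < h)
    (hh4 : h ≤ 1 / 4) (hsmall : h ^ (1 - α * β) ≤ 1 / 4)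
    (hZ : Measurable (Function.uncurry Z)) (hZc : ∀ ω, Continuous fun t => Z t ω)
    (hZB : ∀ᵐ ω ∂P, ∀ t ∈ Set.Icc (0 : ℝ) 1, Z t ω = samplePath B ω t) :
    Integrable (fun ω => (incrementEnergy (α * β) p h (fun t => Z t ω)
        - meanIncrementEnergy B P (α * β) p h) ^ 2) P ∧
      ∫ ω, (incrementEnergy (α * β) p h (fun t => Z t ω)
        - meanIncrementEnergy B P (α * β) p h) ^ 2 ∂P
      ≤ 2 * p * (gaussianSumMomentBound (2 * p) + gaussianSumMomentBound p ^ 2)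
          * (12 * h ^ (1 - α * β))
        + √2 ^ (p * 2) * gaussianAbsMoment (p * 2) * (4 * √h) := by
  have := hB.isGaussianProcess.isProbabilityMeasure
  have hp0 : 0 ≤ p := by linarith
  obtain ⟨hFm, hmm⟩ := measurable_integral_incrementPower (P := P) hZ (α * β) p h
  let F : ℝ → Ω → ℝ := fun x ω => |(h ^ (α * β))⁻¹ * (Z (x + h) ω - Z x ω)| ^ p
  let S : ℝ → Ω → ℝ := fun x ω => |scaledIncrement B (α * β) h x ω| ^ p
  let g : ℝ → Ω → ℝ := fun x ω => F x ω - ∫ ω', F x ω' ∂P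
  have hFS : ∀ x ∈ Set.Icc 0 (1 - h), F x =ᵐ[P] S x := fun x hx =>
    ae_scaledIncrement_eq hZB _ hh hx
  have hmean : ∀ x ∈ Set.Icc 0 (1 - h), ∫ ω, F x ω ∂P = ∫ ω, S x ω ∂P := fun x hx =>
    integral_congr_ae (hFS x hx)
  have hgS : ∀ x ∈ Set.Icc 0 (1 - h), g x =ᵐ[P] fun ω => S x ω - ∫ ω', S x ω' ∂P :=
    fun x hx => by
      filter_upwards [hFS x hx] with ω hω
      simp only [g, hω, hmean x hx]
  have hS2 : ∀ x, MemLp (S x) 2 P := fun x =>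
    memLp_two_abs_rpow_of_hasGaussianLaw hp0 (hB.hasGaussianLaw_scaledIncrement _ h x x).fst
  have hgmeas : Measurable (Function.uncurry g) := hFm.sub (hmm.comp measurable_fst)
  have hcov : ∀ x ∈ Set.Icc 0 (1 - h), ∀ y ∈ Set.Icc 0 (1 - h),
      ∫ ω, g x ω * g y ω ∂P = cov[S x, S y; P] := fun x hx y hy => by
    refine integral_congr_ae ?_
    filter_upwards [hgS x hx, hgS y hy] with ω h1 h2
    rw [h1, h2]
  set M := √2 ^ (p * 2) * gaussianAbsMoment (p * 2) with hMdef
  have hM : ∀ x ∈ Set.Icc 0 (1 - h),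
      Integrable (fun ω => g x ω ^ 2) P ∧ ∫ ω, g x ω ^ 2 ∂P ≤ M := fun x hx => by
    have hc : (fun ω => g x ω ^ 2) =ᵐ[P] fun ω => (S x ω - ∫ ω', S x ω' ∂P) ^ 2 := by
      filter_upwards [hgS x hx] with ω h1
      rw [h1]
    refine ⟨((hS2 x).sub (memLp_const _)).integrable_sq.congr hc.symm, ?_⟩
    rw [integral_congr_ae hc, ← variance_eq_integral (hS2 x).aemeasurable]
    refine (variance_le_expectation_sq (hS2 x).aestronglyMeasurable).trans ?_
    have e : ∀ ω, (S x ^ 2) ω = |scaledIncrement B (α * β) h x ω| ^ (p * 2) := fun ω => by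
      simp only [S, Pi.pow_apply]
      rw [Real.rpow_mul (abs_nonneg _)]; norm_cast
    simp_rw [e]
    exact integral_abs_rpow_le_of_hasGaussianLaw (by positivity)
      (hB.hasGaussianLaw_scaledIncrement _ h x x).fst (hB.integral_scaledIncrement _ h x)
      (hB.variance_scaledIncrement_le hα0 hβ0 hβ1 hx.1 hh)
  set A := 2 * p * (gaussianSumMomentBound (2 * p) + gaussianSumMomentBound p ^ 2)
    * (12 * h ^ (1 - α * β)) with hAdef
  have hC0 : 0 ≤ 2 * p * (gaussianSumMomentBound (2 * p) + gaussianSumMomentBound p ^ 2) :=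
    mul_nonneg (by positivity)
      (add_nonneg (gaussianSumMomentBound_nonneg _) (sq_nonneg _))
  have hA0 : 0 ≤ A := mul_nonneg hC0 (by positivity)
  have hM0 : 0 ≤ M := mul_nonneg (by positivity) (gaussianAbsMoment_nonneg _)
  set μ := volume.restrict (Set.Icc 0 (1 - h)) with hμ
  -- `A` bounds the covariance for well-separated pairs; on the near set the second-moment bound `M`
  -- suffices because that set is small.
  let K : ℝ × ℝ → ℝ := fun z => A + (nearSet (√h)).indicator (fun _ => M) z
  have hK1 : Integrable (fun _ : ℝ × ℝ => A) (μ.prod μ) := integrable_const A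
  have hK2 : Integrable ((nearSet (√h)).indicator fun _ : ℝ × ℝ => M) (μ.prod μ) :=
    (integrable_const M).indicator (measurableSet_nearSet _)
  have hKle : ∀ᵐ z ∂μ.prod μ, |∫ ω, g z.1 ω * g z.2 ω ∂P| ≤ K z := by
    have hz : ∀ᵐ z ∂μ.prod μ, z ∈ Set.Icc 0 (1 - h) ×ˢ Set.Icc 0 (1 - h) := by
      rw [hμ, Measure.prod_restrict]
      exact ae_restrict_mem (measurableSet_Icc.prod measurableSet_Icc)
    filter_upwards [hz] with z hz
    by_cases hn : z ∈ nearSet (√h)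
    · simp only [K, Set.indicator_of_mem hn]
      have h1 := hM z.1 hz.1
      have h2 := hM z.2 hz.2
      have h3 : |∫ ω, g z.1 ω * g z.2 ω ∂P| ≤ ∫ ω, (g z.1 ω ^ 2 + g z.2 ω ^ 2) / 2 ∂P := by
        refine norm_integral_le_of_norm_le (f := fun ω => g z.1 ω * g z.2 ω)
          ((h1.1.add h2.1).div_const 2) (ae_of_all _ fun ω => ?_)
        rw [Real.norm_eq_abs, abs_le]
        constructor <;>
          nlinarith [sq_nonneg (g z.1 ω - g z.2 ω), sq_nonneg (g z.1 ω + g z.2 ω)]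
      rw [integral_div, integral_add h1.1 h2.1] at h3
      linarith [h1.2, h2.2]
    · simp only [K, Set.indicator_of_notMem hn, add_zero]
      simp only [nearSet, Set.mem_ofPred_eq, not_or, not_lt] at hn
      rw [hcov _ hz.1 _ hz.2]
      refine (abs_covariance_abs_rpow_le hp (hB.hasGaussianLaw_scaledIncrement _ h z.1 z.2)
        (hB.integral_scaledIncrement _ h z.1) (hB.integral_scaledIncrement _ h z.2)
        (hB.le_variance_scaledIncrement hα0 hα1 hβ0 hβ1 hn.1 hh hsmall)
        (hB.variance_scaledIncrement_le hα0 hβ0 hβ1 hz.1.1 hh)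
        (hB.variance_scaledIncrement_le hα0 hβ0 hβ1 hz.2.1 hh)).trans ?_
      exact mul_le_mul_of_nonneg_left
        (hB.abs_covariance_scaledIncrement_le hα0 hα1 hβ0 hβ1 hn.1 hn.2.1 hn.2.2 hh hh4) hC0
  have hmain := integral_sq_integral_le (μ := μ) (P := P) hgmeas (M := M) (K := K)
    (by filter_upwards [ae_restrict_mem measurableSet_Icc] with x hx using hM x hx)
    (hK1.add hK2) hKle
  have hdiff : ∀ ω, ∫ x, g x ω ∂μ = incrementEnergy (α * β) p h (fun t => Z t ω)
      - meanIncrementEnergy B P (α * β) p h := fun ω => by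
    have hcont : Continuous fun x => F x ω := by
      have h1 := hZc ω
      have h2 : Continuous fun x => Z (x + h) ω := h1.comp (continuous_add_const h)
      exact ((continuous_const.mul (h2.sub h1)).abs).rpow_const fun _ => Or.inr hp0
    have i1 : Integrable (fun x => F x ω) μ := hcont.continuousOn.integrableOn_Icc
    have i2 : Integrable (fun x => ∫ ω', F x ω' ∂P) μ :=
      (hB.integrableOn_mean hα0 hβ0 hβ1 hp hh hZ hZB).congr_fun
        (fun x hx => (hmean x hx).symm) measurableSet_Icc
    change ∫ x, (F x ω - ∫ ω', F x ω' ∂P) ∂μ = _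
    rw [integral_sub i1 i2]
    congr 1
    exact setIntegral_congr_fun measurableSet_Icc hmean
  simp_rw [hdiff] at hmain
  refine ⟨hmain.1, hmain.2.trans ?_⟩
  have hb : 1 - h ≤ 1 := by linarith
  have hnear := measure_nearSet_le (b := 1 - h) (r := √h) hb (Real.sqrt_nonneg h)
  rw [← hμ] at hnear
  have hμ1 : (μ.prod μ).real Set.univ ≤ 1 := by
    have h1 : μ Set.univ ≤ 1 := by
      rw [hμ, Measure.restrict_apply_univ, Real.volume_Icc]
      exact ENNReal.ofReal_le_one.2 (by linarith)
    refine ENNReal.toReal_le_of_le_ofReal zero_le_one ?_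
    rw [← Set.univ_prod_univ, Measure.prod_prod, ENNReal.ofReal_one]
    exact mul_le_one' h1 h1
  simp only [K]
  rw [integral_add hK1 hK2, integral_const, integral_indicator (measurableSet_nearSet _),
    setIntegral_const, smul_eq_mul, smul_eq_mul]
  have hr : (μ.prod μ).real (nearSet (√h)) ≤ 4 * √h :=
    ENNReal.toReal_le_of_le_ofReal (by positivity) hnear
  have t1 : (μ.prod μ).real Set.univ * A ≤ A := mul_le_of_le_one_left hA0 hμ1
  have t2 : (μ.prod μ).real (nearSet (√h)) * M ≤ 4 * √h * M := by gcongr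
  linarith

/-- Almost surely, the increment energies along the dyadic scales are bounded, and bounded
away from zero. -/
lemma ae_incrementEnergy_bounds (hB : IsBifractionalBrownianMotion α β B P)
    (hα0 : 0 < α) (hα1 : α < 1) (hβ0 : 0 < β) (hβ1 : β ≤ 1) (hp : 1 ≤ p)
    (hcont : ∀ᵐ ω ∂P, ContinuousOn (samplePath B ω) (Set.Icc 0 1)) :
    ∃ c : ℝ, 0 < c ∧ ∀ᵐ ω ∂P,
      (∃ K, ∀ n : ℕ, incrementEnergy (α * β) p ((1 / 2) ^ n) (samplePath B ω) ≤ K) ∧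
      ∀ᶠ n : ℕ in atTop, c ≤ incrementEnergy (α * β) p ((1 / 2) ^ n) (samplePath B ω) := by
  have := hB.isGaussianProcess.isProbabilityMeasure
  have hγ1 : α * β < 1 := by nlinarith
  obtain ⟨Z, hZ, hZc, hZB⟩ := exists_measurable_continuous_version
    (W := fun t ω => samplePath B ω t)
    (fun t => hB.isGaussianProcess_samplePath.aemeasurable t) hcont
  have hpow : ∀ n : ℕ, 0 < ((1 : ℝ) / 2) ^ n := fun n => by positivity
  have hpow1 : ∀ n : ℕ, ((1 : ℝ) / 2) ^ n ≤ 1 := fun n =>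
    pow_le_one₀ (by norm_num) (by norm_num)
  have hlim : Tendsto (fun n : ℕ => ((1 : ℝ) / 2) ^ n) atTop (𝓝 0) :=
    tendsto_pow_atTop_nhds_zero_of_lt_one (by norm_num) (by norm_num)
  have e1 : ∀ᶠ n : ℕ in atTop, ((1 : ℝ) / 2) ^ n ≤ 1 / 4 :=
    (hlim.eventually_lt_const (by norm_num : (0 : ℝ) < 1 / 4)).mono fun _ h => h.le
  have e2 : ∀ᶠ n : ℕ in atTop, (((1 : ℝ) / 2) ^ n) ^ (1 - α * β) ≤ 1 / 4 := by
    have : Tendsto (fun n : ℕ => (((1 : ℝ) / 2) ^ n) ^ (1 - α * β)) atTop (𝓝 0) := by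
      have h0 : (0 : ℝ) ^ (1 - α * β) = 0 := Real.zero_rpow (by linarith)
      have := hlim.rpow_const (p := 1 - α * β) (Or.inr (by linarith))
      rwa [h0] at this
    exact (this.eventually_lt_const (by norm_num : (0 : ℝ) < 1 / 4)).mono fun _ h => h.le
  have hgeom : ∀ s : ℝ, 0 < s → Summable fun n : ℕ => (((1 : ℝ) / 2) ^ n) ^ s := fun s hs => by
    have : ∀ n : ℕ, (((1 : ℝ) / 2) ^ n) ^ s = (((1 : ℝ) / 2) ^ s) ^ n := fun n =>
      (Real.rpow_pow_comm (by norm_num) s n).symm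
    simp_rw [this]
    exact summable_geometric_of_lt_one (by positivity)
      (Real.rpow_lt_one (by norm_num) (by norm_num) hs)
  have hsum : Summable fun n : ℕ =>
      2 * p * (gaussianSumMomentBound (2 * p) + gaussianSumMomentBound p ^ 2)
          * (12 * (((1 : ℝ) / 2) ^ n) ^ (1 - α * β))
        + √2 ^ (p * 2) * gaussianAbsMoment (p * 2) * (4 * √(((1 : ℝ) / 2) ^ n)) := by
    simp_rw [Real.sqrt_eq_rpow (_ ^ _)]
    exact (((hgeom _ (by linarith)).mul_left _).mul_left _).add
      (((hgeom _ (by norm_num)).mul_left _).mul_left _)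
  have hconv := ae_tendsto_zero_of_summable_integral_sq (P := P)
    (Y := fun n ω => incrementEnergy (α * β) p ((1 / 2) ^ n) (fun t => Z t ω)
        - meanIncrementEnergy B P (α * β) p ((1 / 2) ^ n))
    (by filter_upwards [e1, e2] with n h1 h2 using
          hB.integral_sq_incrementEnergy_sub_le hα0 hα1 hβ0 hβ1 hp (hpow n) h1 h2 hZ hZc hZB)
    hsum
  set a := √(1 / 2) ^ p * gaussianAbsMoment p with ha
  have ha0 : 0 < a := mul_pos (by positivity) (gaussianAbsMoment_pos (by linarith))
  -- The mean is eventually at least a/4, and the fluctuation eventually exceeds -a/8.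
  refine ⟨1 / 8 * a, by positivity, ?_⟩
  filter_upwards [hconv, hZB] with ω hω hZω
  have heq : ∀ n : ℕ, incrementEnergy (α * β) p ((1 / 2) ^ n) (fun t => Z t ω)
      = incrementEnergy (α * β) p ((1 / 2) ^ n) (samplePath B ω) := fun n => by
    refine setIntegral_congr_fun measurableSet_Icc fun x hx => ?_
    have := hpow n
    simp only [hZω x ⟨hx.1, by linarith [hx.2]⟩,
      hZω (x + (1 / 2) ^ n) ⟨by linarith [hx.1], by linarith [hx.2]⟩]
  simp_rw [heq] at hω
  constructor
  · obtain ⟨K, hK⟩ := hω.bddAbove_range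
    refine ⟨K + √2 ^ p * gaussianAbsMoment p, fun n => ?_⟩
    have h1 := hK (Set.mem_range_self n)
    have h2 := hB.meanIncrementEnergy_le hα0 hβ0 hβ1 hp (hpow n) (hpow1 n) hZ hZB
    linarith
  · filter_upwards [e1, e2, hω.eventually_const_lt (by linarith : -(1 / 8 * a) < 0)]
      with n h1 h2 h3
    have := hB.le_meanIncrementEnergy hα0 hα1 hβ0 hβ1 hp (hpow n) h1 h2 hZ hZB
    linarith

end IsBifractionalBrownianMotion

/-! ### From dyadic increment energies to Besov regularity -/

/-- The points of `[0, 1]` which remain in `[0, 1]` when translated by `s`. -/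
def translationDomain (s : ℝ) : Set ℝ := {x | x ∈ Set.Icc (0 : ℝ) 1 ∧ x + s ∈ Set.Icc (0 : ℝ) 1}

/-- The `L^p` norm of `x ↦ f (x + s) - f x` over the part of `[0, 1]` where it is defined. -/
noncomputable def translationNorm (p : ℝ) (f : ℝ → ℝ) (s : ℝ) : ℝ≥0∞ :=
  (∫⁻ x in translationDomain s, ENNReal.ofReal |f (x + s) - f x| ^ p) ^ (1 / p)

lemma lpModulus_eq_iSup (p : ℝ) (f : ℝ → ℝ) (t : ℝ) :
    lpModulus p f (Set.Icc 0 1) t = ⨆ (s : ℝ) (_ : |s| ≤ t), translationNorm p f s := rfl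

lemma measurableSet_translationDomain (s : ℝ) : MeasurableSet (translationDomain s) :=
  measurableSet_Icc.inter (measurableSet_Icc.preimage (measurable_add_const s))

lemma translationDomain_eq_Icc {s : ℝ} (hs : 0 ≤ s) : translationDomain s = Set.Icc 0 (1 - s) := by
  ext x
  simp only [translationDomain, Set.mem_ofPred_eq, Set.mem_Icc]
  constructor
  · rintro ⟨⟨h1, _⟩, _, h2⟩; exact ⟨h1, by linarith⟩
  · rintro ⟨h1, h2⟩; exact ⟨⟨h1, by linarith⟩, by linarith, by linarith⟩

/-- With the congruence lemmas that follow, this allows a path to be replaced by a continuous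
extension of its restriction to [0, 1]. -/
lemma translationNorm_congr {p : ℝ} {f g : ℝ → ℝ} (hfg : Set.EqOn f g (Set.Icc 0 1)) (s : ℝ) :
    translationNorm p f s = translationNorm p g s := by
  unfold translationNorm
  congr 1
  refine setLIntegral_congr_fun (measurableSet_translationDomain s) fun x hx => ?_
  simp only [hfg hx.1, hfg hx.2]

lemma lpModulus_congr {p : ℝ} {f g : ℝ → ℝ} (hfg : Set.EqOn f g (Set.Icc 0 1)) :
    lpModulus p f (Set.Icc 0 1) = lpModulus p g (Set.Icc 0 1) := by
  ext t
  simp_rw [lpModulus_eq_iSup, translationNorm_congr hfg]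

lemma ae_eq_restrict_of_eqOn {f g : ℝ → ℝ} (hfg : Set.EqOn f g (Set.Icc 0 1)) :
    f =ᵐ[volume.restrict (Set.Icc 0 1)] g :=
  (ae_restrict_mem measurableSet_Icc).mono fun _ hx => hfg hx

lemma mem_Bes_congr {γ p : ℝ} {f g : ℝ → ℝ} (hfg : Set.EqOn f g (Set.Icc 0 1)) :
    f ∈ Bes γ p (Set.Icc 0 1) ↔ g ∈ Bes γ p (Set.Icc 0 1) := by
  have hae := ae_eq_restrict_of_eqOn hfg
  simp only [Bes, besovNorm, Set.mem_ofPred_eq, lpModulus_congr hfg, memLp_congr_ae hae,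
    eLpNorm_congr_ae hae]

lemma mem_bes_congr {γ p : ℝ} {f g : ℝ → ℝ} (hfg : Set.EqOn f g (Set.Icc 0 1)) :
    f ∈ bes γ p (Set.Icc 0 1) ↔ g ∈ bes γ p (Set.Icc 0 1) := by
  simp only [bes, Set.mem_ofPred_eq, lpModulus_congr hfg,
    memLp_congr_ae (ae_eq_restrict_of_eqOn hfg)]

lemma incrementEnergy_congr {γ p h : ℝ} (hh : 0 ≤ h) {f g : ℝ → ℝ}
    (hfg : Set.EqOn f g (Set.Icc 0 1)) :
    incrementEnergy γ p h f = incrementEnergy γ p h g := by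
  refine setIntegral_congr_fun measurableSet_Icc fun x hx => ?_
  simp only [hfg ⟨hx.1, by linarith [hx.2]⟩,
    hfg (show x + h ∈ Set.Icc (0 : ℝ) 1 from ⟨by linarith [hx.1], by linarith [hx.2]⟩)]

section Translation

variable {p : ℝ} {g : ℝ → ℝ}

lemma translationNorm_zero (hp : 1 ≤ p) : translationNorm p g 0 = 0 := by
  have hp0 : 0 < p := by linarith
  simp [translationNorm, ENNReal.zero_rpow_of_pos hp0, hp0]

lemma translationNorm_neg (p : ℝ) (g : ℝ → ℝ) (s : ℝ) :
    translationNorm p g (-s) = translationNorm p g s := by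
  unfold translationNorm
  congr 1
  rw [← lintegral_indicator (measurableSet_translationDomain _),
    ← lintegral_indicator (measurableSet_translationDomain _),
    ← lintegral_add_right_eq_self _ s]
  congr 1
  ext x
  have hiff : x + s ∈ translationDomain (-s) ↔ x ∈ translationDomain s := by
    simp only [translationDomain, Set.mem_ofPred_eq, add_neg_cancel_right]
    exact and_comm
  by_cases hx : x ∈ translationDomain s
  · rw [Set.indicator_of_mem hx, Set.indicator_of_mem (hiff.2 hx), add_neg_cancel_right,
      abs_sub_comm]
  · rw [Set.indicator_of_notMem hx, Set.indicator_of_notMem (fun h => hx (hiff.1 h))]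

lemma measurable_translate_sub (hg : Continuous g) (s : ℝ) :
    Measurable fun x => ENNReal.ofReal |g (x + s) - g x| := by
  have := hg.measurable
  fun_prop

/-- Minkowski's inequality, passing through g(x + s). A point with x and x + s + t in [0, 1] also
has x + s there, since both shifts are nonnegative. -/
lemma translationNorm_add_le (hp : 1 ≤ p) (hg : Continuous g) {s t : ℝ} (hs : 0 ≤ s)
    (ht : 0 ≤ t) :
    translationNorm p g (s + t) ≤ translationNorm p g t + translationNorm p g s := by
  have hp0 : 0 < p := by linarith
  have hmt := measurable_translate_sub hg t
  have hms := measurable_translate_sub hg s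
  have hmt' : Measurable fun x => ENNReal.ofReal |g (x + s + t) - g (x + s)| :=
    hmt.comp (measurable_add_const s)
  have hsub : ∀ x ∈ translationDomain (s + t), x ∈ translationDomain s ∧
      x + s ∈ translationDomain t := fun x hx => by
    rw [translationDomain_eq_Icc (add_nonneg hs ht)] at hx
    rw [translationDomain_eq_Icc hs, translationDomain_eq_Icc ht]
    exact ⟨⟨hx.1, by linarith [hx.2]⟩, by linarith [hx.1], by linarith [hx.2]⟩
  have h1 : translationNorm p g (s + t) ≤ (∫⁻ x in translationDomain (s + t),
      ((fun x => ENNReal.ofReal |g (x + s + t) - g (x + s)|)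
        + fun x => ENNReal.ofReal |g (x + s) - g x|) x ^ p) ^ (1 / p) := by
    unfold translationNorm
    refine ENNReal.rpow_le_rpow (lintegral_mono fun x => ?_) (by positivity)
    refine ENNReal.rpow_le_rpow ?_ hp0.le
    simp only [Pi.add_apply]
    rw [← ENNReal.ofReal_add (abs_nonneg _) (abs_nonneg _), ← add_assoc]
    exact ENNReal.ofReal_le_ofReal (abs_sub_le _ _ _)
  refine h1.trans ((ENNReal.lintegral_Lp_add_le hmt'.aemeasurable hms.aemeasurable hp).trans
    (add_le_add ?_ ?_))
  · unfold translationNorm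
    refine ENNReal.rpow_le_rpow ?_ (by positivity)
    rw [← lintegral_indicator (measurableSet_translationDomain _),
      ← lintegral_indicator (measurableSet_translationDomain _),
      ← lintegral_add_right_eq_self ((translationDomain t).indicator _) s]
    refine lintegral_mono fun x => ?_
    by_cases hx : x ∈ translationDomain (s + t)
    · rw [Set.indicator_of_mem hx, Set.indicator_of_mem (hsub x hx).2]
    · rw [Set.indicator_of_notMem hx]
      exact zero_le
  · exact ENNReal.rpow_le_rpow (lintegral_mono_set fun x hx => (hsub x hx).1) (by positivity)

/-- Fatou's lemma. Approximating from below matters: `u n ≤ s` makes the domain for `s` part of the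
domain for `u n`. -/
lemma translationNorm_le_of_tendsto (hp : 1 ≤ p) (hg : Continuous g) {s : ℝ} {u : ℕ → ℝ}
    (hu0 : ∀ n, 0 ≤ u n) (hus : ∀ n, u n ≤ s) (hlim : Tendsto u atTop (𝓝 s)) {L : ℝ≥0∞}
    (hL : ∀ n, translationNorm p g (u n) ≤ L) : translationNorm p g s ≤ L := by
  have hp0 : 0 < p := by linarith
  have hs : 0 ≤ s := (hu0 0).trans (hus 0)
  have hbound : ∀ n, ∫⁻ x in translationDomain s, ENNReal.ofReal |g (x + u n) - g x| ^ p
      ≤ L ^ p := fun n => by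
    have hsub : translationDomain s ⊆ translationDomain (u n) := by
      rw [translationDomain_eq_Icc hs, translationDomain_eq_Icc (hu0 n)]
      exact Set.Icc_subset_Icc_right (by linarith [hus n])
    refine (lintegral_mono_set hsub).trans ?_
    have := hL n
    unfold translationNorm at this
    rwa [one_div, ENNReal.rpow_inv_le_iff hp0] at this
  unfold translationNorm
  rw [one_div, ENNReal.rpow_inv_le_iff hp0]
  have hpt : ∀ x, Tendsto (fun n => ENNReal.ofReal |g (x + u n) - g x| ^ p) atTop
      (𝓝 (ENNReal.ofReal |g (x + s) - g x| ^ p)) := fun x => by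
    have h1 : Tendsto (fun n => |g (x + u n) - g x|) atTop (𝓝 |g (x + s) - g x|) :=
      (((hg.tendsto _).comp (hlim.const_add x)).sub_const _).abs
    exact (ENNReal.continuous_rpow_const.tendsto _).comp (ENNReal.tendsto_ofReal h1)
  calc ∫⁻ x in translationDomain s, ENNReal.ofReal |g (x + s) - g x| ^ p
      = ∫⁻ x in translationDomain s,
          liminf (fun n => ENNReal.ofReal |g (x + u n) - g x| ^ p) atTop :=
        lintegral_congr fun x => (hpt x).liminf_eq.symm
    _ ≤ liminf (fun n => ∫⁻ x in translationDomain s,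
          ENNReal.ofReal |g (x + u n) - g x| ^ p) atTop :=
        lintegral_liminf_le fun n => (measurable_translate_sub hg _).pow_const p
    _ ≤ liminf (fun _ : ℕ => L ^ p) atTop :=
        liminf_le_liminf (Eventually.of_forall hbound)
    _ = L ^ p := liminf_const _

/-- A subadditive function bounded by `K θ ^ n` at `2 ^ (-n)` is bounded at all dyadic points. -/
lemma dyadic_le_of_subadditive {N : ℝ → ℝ≥0∞} (h0 : N 0 = 0)
    (hadd : ∀ s t, 0 ≤ s → 0 ≤ t → N (s + t) ≤ N t + N s) {K θ : ℝ≥0∞}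
    (hK : ∀ n : ℕ, N ((1 / 2) ^ n) ≤ K * θ ^ n) (j k m : ℕ) (hm : m < 2 ^ k) :
    N (m * (1 / 2) ^ (j + k)) ≤ ∑ i ∈ Finset.range k, K * θ ^ (j + 1 + i) := by
  induction k generalizing m with
  | zero =>
    obtain rfl : m = 0 := by simpa using hm
    simp [h0]
  | succ k ih =>
    have hm' : m / 2 < 2 ^ k := by
      rw [Nat.div_lt_iff_lt_mul (by norm_num)]
      rwa [pow_succ] at hm
    -- Split off the last binary digit: the quotient goes to the induction hypothesis, the remainder
    -- costs at most one shift 2^(-(j+k+1)).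
    have hdec : (m : ℝ) = 2 * (m / 2 : ℕ) + (m % 2 : ℕ) := by
      exact_mod_cast (Nat.div_add_mod m 2).symm
    have hsplit : (m : ℝ) * (1 / 2) ^ (j + (k + 1))
        = (m / 2 : ℕ) * (1 / 2) ^ (j + k) + (m % 2 : ℕ) * (1 / 2) ^ (j + (k + 1)) := by
      rw [hdec, ← add_assoc j k 1, pow_succ]
      ring
    rw [hsplit, Finset.sum_range_succ]
    refine (hadd _ _ (by positivity) (by positivity)).trans ?_
    rw [add_comm]
    refine add_le_add (ih _ hm') ?_
    rcases Nat.mod_two_eq_zero_or_one m with h | h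
    · simp [h, h0]
    · rw [h, Nat.cast_one, one_mul, show j + 1 + k = j + (k + 1) by ring]
      exact hK _

lemma exists_dyadic_seq {s : ℝ} (hs : 0 < s) {j : ℕ} (hsj : s ≤ (1 / 2) ^ j) :
    ∃ m : ℕ → ℕ, (∀ k, m k < 2 ^ k) ∧ (∀ k, (m k : ℝ) * (1 / 2) ^ (j + k) ≤ s) ∧
      Tendsto (fun k => (m k : ℝ) * (1 / 2) ^ (j + k)) atTop (𝓝 s) := by
  have hinv : ∀ n : ℕ, (2 : ℝ) ^ n * (1 / 2) ^ n = 1 := fun n => by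
    rw [← mul_pow]; norm_num
  have hceil : ∀ k, 1 ≤ ⌈s * 2 ^ (j + k)⌉₊ := fun k => Nat.one_le_ceil_iff.2 (by positivity)
  have hcast : ∀ k, ((⌈s * 2 ^ (j + k)⌉₊ - 1 : ℕ) : ℝ) = ⌈s * 2 ^ (j + k)⌉₊ - 1 := fun k => by
    rw [Nat.cast_sub (hceil k), Nat.cast_one]
  have hlt : ∀ k, (⌈s * 2 ^ (j + k)⌉₊ : ℝ) < s * 2 ^ (j + k) + 1 := fun k =>
    Nat.ceil_lt_add_one (by positivity)
  have hup : ∀ k, ((⌈s * 2 ^ (j + k)⌉₊ - 1 : ℕ) : ℝ) * (1 / 2) ^ (j + k) ≤ s := fun k => by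
    calc ((⌈s * 2 ^ (j + k)⌉₊ - 1 : ℕ) : ℝ) * (1 / 2) ^ (j + k)
        ≤ (s * 2 ^ (j + k)) * (1 / 2) ^ (j + k) := by
          rw [hcast]; gcongr; linarith [hlt k]
      _ = s := by rw [mul_assoc, hinv, mul_one]
  have hlow : ∀ k, s - (1 / 2) ^ (j + k)
      ≤ ((⌈s * 2 ^ (j + k)⌉₊ - 1 : ℕ) : ℝ) * (1 / 2) ^ (j + k) := fun k => by
    calc s - (1 / 2) ^ (j + k) = (s * 2 ^ (j + k) - 1) * (1 / 2) ^ (j + k) := by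
          rw [sub_mul, mul_assoc, hinv]; ring
      _ ≤ _ := by
          rw [hcast]; gcongr; exact Nat.le_ceil _
  -- Ceiling minus one rather than floor keeps `m k < 2 ^ k` strict even at s = 2^(-j).
  refine ⟨fun k => ⌈s * 2 ^ (j + k)⌉₊ - 1, fun k => ?_, hup, ?_⟩
  · have h1 : s * 2 ^ (j + k) ≤ ((2 ^ k : ℕ) : ℝ) := by
      calc s * 2 ^ (j + k) ≤ (1 / 2) ^ j * 2 ^ (j + k) := by gcongr
        _ = (2 ^ j * (1 / 2) ^ j) * 2 ^ k := by ring
        _ = ((2 ^ k : ℕ) : ℝ) := by rw [hinv]; push_cast; ring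
    have h2 := Nat.ceil_le.2 h1
    have h3 := hceil k
    simp only
    omega
  · have h1 : Tendsto (fun k : ℕ => s - (1 / 2 : ℝ) ^ (j + k)) atTop (𝓝 s) := by
      have h2 : Tendsto (fun n : ℕ => (1 / 2 : ℝ) ^ n) atTop (𝓝 0) :=
        tendsto_pow_atTop_nhds_zero_of_lt_one (by norm_num) (by norm_num)
      have h3 : Tendsto (fun k : ℕ => j + k) atTop atTop :=
        tendsto_atTop_mono (fun k => Nat.le_add_left k j) tendsto_id
      simpa using (h2.comp h3).const_sub s
    exact tendsto_of_tendsto_of_tendsto_of_le_of_le h1 tendsto_const_nhds hlow hup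

lemma translationNorm_le_of_dyadic {γ : ℝ} (hγ : 0 < γ) (hp : 1 ≤ p) (hg : Continuous g)
    {K : ℝ≥0∞} (hK : ∀ n : ℕ, translationNorm p g ((1 / 2) ^ n)
      ≤ K * ENNReal.ofReal (((1 / 2) ^ n) ^ γ)) {s : ℝ} (hs0 : 0 ≤ s) (hs1 : s ≤ 1) :
    translationNorm p g s ≤ K * (1 - ENNReal.ofReal ((1 / 2) ^ γ))⁻¹
      * ENNReal.ofReal (2 ^ γ) * ENNReal.ofReal (s ^ γ) := by
  rcases hs0.eq_or_lt with rfl | hs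
  · rw [translationNorm_zero hp]; exact zero_le
  set θ := ENNReal.ofReal ((1 / 2) ^ γ) with hθ
  have hpow : ∀ n : ℕ, ENNReal.ofReal (((1 / 2) ^ n) ^ γ) = θ ^ n := fun n => by
    rw [hθ, ← ENNReal.ofReal_pow (by positivity), Real.rpow_pow_comm (by norm_num)]
  simp_rw [hpow] at hK
  -- Locate 2^(-j-1) < s ≤ 2^(-j): the geometric series is then of order θ^j = 2^(-jγ), and 2^(-j) <
  -- 2s produces the factor 2^γ.
  obtain ⟨j, hj1, hj2⟩ := exists_nat_pow_near_of_lt_one hs hs1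
    (by norm_num : (0 : ℝ) < 1 / 2) (by norm_num)
  obtain ⟨m, hm, hms, hmlim⟩ := exists_dyadic_seq hs hj2
  have hbound : ∀ k, translationNorm p g (m k * (1 / 2) ^ (j + k)) ≤ K * (1 - θ)⁻¹ * θ ^ j :=
    fun k => by
      refine (dyadic_le_of_subadditive (translationNorm_zero hp)
        (fun a b ha hb => translationNorm_add_le hp hg ha hb) hK j k (m k) (hm k)).trans ?_
      have hθ1 : θ ≤ 1 := ENNReal.ofReal_le_one.2
        (Real.rpow_le_one (by norm_num) (by norm_num) hγ.le)
      calc ∑ i ∈ Finset.range k, K * θ ^ (j + 1 + i)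
          ≤ ∑ i ∈ Finset.range k, K * θ ^ j * θ ^ i := by
            refine Finset.sum_le_sum fun i _ => ?_
            rw [mul_assoc, ← pow_add]
            exact mul_le_mul' le_rfl (pow_le_pow_right_of_le_one' hθ1 (by omega))
        _ = K * θ ^ j * ∑ i ∈ Finset.range k, θ ^ i := by rw [Finset.mul_sum]
        _ ≤ K * θ ^ j * (1 - θ)⁻¹ := by
            rw [← ENNReal.tsum_geometric]
            gcongr
            exact ENNReal.sum_le_tsum _
        _ = _ := by ring
  refine (translationNorm_le_of_tendsto hp hg (fun k => by positivity) hms hmlim hbound).trans ?_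
  rw [mul_assoc (K * (1 - θ)⁻¹)]
  gcongr
  rw [← hpow, ← ENNReal.ofReal_mul (by positivity), ← Real.mul_rpow (by norm_num) hs.le]
  refine ENNReal.ofReal_le_ofReal (Real.rpow_le_rpow (by positivity) ?_ hγ.le)
  rw [pow_succ] at hj1
  linarith

lemma translationNorm_eq_incrementEnergy {γ h : ℝ} (hp : 1 ≤ p) (hg : Continuous g)
    (hh : 0 < h) :
    translationNorm p g h
      = ENNReal.ofReal (h ^ γ) * ENNReal.ofReal (incrementEnergy γ p h g ^ (1 / p)) := by
  have hp0 : 0 < p := by linarith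
  have hγ0 : 0 < h ^ γ := by positivity
  have hE0 : 0 ≤ incrementEnergy γ p h g := integral_nonneg fun _ => by positivity
  have hcont : Continuous fun x => |(h ^ γ)⁻¹ * (g (x + h) - g x)| ^ p :=
    ((continuous_const.mul ((hg.comp (continuous_add_const h)).sub hg)).abs).rpow_const
      fun _ => Or.inr hp0.le
  have hint : ∫⁻ x in Set.Icc 0 (1 - h), ENNReal.ofReal |g (x + h) - g x| ^ p
      = ENNReal.ofReal (h ^ γ) ^ p * ENNReal.ofReal (incrementEnergy γ p h g) := by
    rw [incrementEnergy, ofReal_integral_eq_lintegral_ofReal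
      hcont.continuousOn.integrableOn_Icc (ae_of_all _ fun _ => by positivity),
      ← lintegral_const_mul _ hcont.measurable.ennreal_ofReal]
    refine lintegral_congr fun x => ?_
    rw [← ENNReal.ofReal_rpow_of_nonneg (abs_nonneg _) hp0.le,
      ← ENNReal.mul_rpow_of_nonneg _ _ hp0.le, ← ENNReal.ofReal_mul hγ0.le, abs_mul,
      abs_of_pos (inv_pos.2 hγ0), mul_inv_cancel_left₀ hγ0.ne']
  unfold translationNorm
  rw [translationDomain_eq_Icc hh.le, hint, ENNReal.mul_rpow_of_nonneg _ _ (by positivity),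
    ← ENNReal.rpow_mul, mul_one_div_cancel hp0.ne', ENNReal.rpow_one,
    ENNReal.ofReal_rpow_of_nonneg hE0 (by positivity)]

lemma memLp_of_continuous (hg : Continuous g) (q : ℝ≥0∞) :
    MemLp g q (volume.restrict (Set.Icc (0 : ℝ) 1)) := by
  obtain ⟨C, hC⟩ := isCompact_Icc.exists_bound_of_continuousOn
    (hg.continuousOn (s := Set.Icc (0 : ℝ) 1))
  exact MemLp.of_bound hg.aestronglyMeasurable C
    ((ae_restrict_mem measurableSet_Icc).mono fun x hx => hC x hx)

lemma mem_Bes_of_incrementEnergy_le {γ K : ℝ} (hγ : 0 < γ) (hp : 1 ≤ p) (hg : Continuous g)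
    (hK : ∀ n : ℕ, incrementEnergy γ p ((1 / 2) ^ n) g ≤ K) : g ∈ Bes γ p (Set.Icc 0 1) := by
  have hp0 : 0 < p := by linarith
  have hmem := memLp_of_continuous hg (ENNReal.ofReal p)
  refine ⟨hmem, ?_⟩
  have hdy : ∀ n : ℕ, translationNorm p g ((1 / 2) ^ n)
      ≤ ENNReal.ofReal (K ^ (1 / p)) * ENNReal.ofReal (((1 / 2) ^ n) ^ γ) := fun n => by
    rw [translationNorm_eq_incrementEnergy (γ := γ) hp hg (by positivity), mul_comm]
    gcongr
    · exact integral_nonneg fun _ => by positivity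
    · exact hK n
  set C := ENNReal.ofReal (K ^ (1 / p)) * (1 - ENNReal.ofReal ((1 / 2) ^ γ))⁻¹
    * ENNReal.ofReal (2 ^ γ) with hC
  have hCtop : C ≠ ∞ := by
    have hθ : ENNReal.ofReal ((1 / 2) ^ γ) < 1 := by
      rw [ENNReal.ofReal_lt_one]
      exact Real.rpow_lt_one (by norm_num) (by norm_num) hγ
    refine ENNReal.mul_ne_top (ENNReal.mul_ne_top ENNReal.ofReal_ne_top ?_)
      ENNReal.ofReal_ne_top
    exact ENNReal.inv_ne_top.2 (tsub_pos_of_lt hθ).ne'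
  have hsup : (⨆ (t : ℝ) (_ : 0 < t ∧ t ≤ 1), lpModulus p g (Set.Icc 0 1) t
      / ENNReal.ofReal (t ^ γ)) ≤ C := by
    refine iSup₂_le fun t ht => ENNReal.div_le_of_le_mul ?_
    rw [lpModulus_eq_iSup]
    refine iSup₂_le fun s hs => ?_
    have habs : translationNorm p g s = translationNorm p g |s| := by
      rcases abs_choice s with h | h
      · rw [h]
      · rw [h, translationNorm_neg]
    rw [habs]
    refine (translationNorm_le_of_dyadic hγ hp hg hdy (abs_nonneg s) (hs.trans ht.2)).trans ?_
    gcongr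
  exact ENNReal.add_lt_top.2 ⟨hmem.eLpNorm_lt_top, hsup.trans_lt hCtop.lt_top⟩

/-- The modulus at t = 2^(-n) dominates the single shift s = t, so its ratio to t^γ stays above
c^(1/p) along this sequence. -/
lemma notMem_bes_of_le_incrementEnergy {γ c : ℝ} (hp : 1 ≤ p) (hg : Continuous g) (hc : 0 < c)
    (hE : ∀ᶠ n : ℕ in atTop, c ≤ incrementEnergy γ p ((1 / 2) ^ n) g) :
    g ∉ bes γ p (Set.Icc 0 1) := by
  rintro ⟨_, hlim⟩
  have hp0 : 0 < p := by linarith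
  have hpow : Tendsto (fun n : ℕ => (1 / 2 : ℝ) ^ n) atTop (𝓝[>] 0) :=
    tendsto_nhdsWithin_iff.2 ⟨tendsto_pow_atTop_nhds_zero_of_lt_one (by norm_num) (by norm_num),
      Eventually.of_forall fun n => by simp⟩
  have hseq := hlim.comp hpow
  have hle : ENNReal.ofReal (c ^ (1 / p)) ≤ 0 := by
    refine ge_of_tendsto hseq ?_
    filter_upwards [hE] with n hn
    have hpos : 0 < ((1 / 2 : ℝ) ^ n) ^ γ := by positivity
    simp only [Function.comp_apply]
    rw [ENNReal.le_div_iff_mul_le (Or.inl (ENNReal.ofReal_pos.2 hpos).ne')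
      (Or.inl ENNReal.ofReal_ne_top), mul_comm]
    have h1 : translationNorm p g ((1 / 2) ^ n) ≤ lpModulus p g (Set.Icc 0 1) ((1 / 2) ^ n) := by
      rw [lpModulus_eq_iSup]
      exact le_iSup₂_of_le ((1 / 2) ^ n) (abs_of_pos (by positivity)).le le_rfl
    refine le_trans ?_ h1
    rw [translationNorm_eq_incrementEnergy (γ := γ) hp hg (by positivity)]
    gcongr
  rw [nonpos_iff_eq_zero, ENNReal.ofReal_eq_zero] at hle
  exact absurd hle (not_le.2 (by positivity))

end Translation

/-! ### The sample path theorem -/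

theorem theorem3p1 {Ω : Type*} [MeasurableSpace Ω] (P : Measure Ω) [IsProbabilityMeasure P]
    (α β p : ℝ) (hα0 : 0 < α) (hα1 : α < 1) (hβ0 : 0 < β) (hβ1 : β ≤ 1)
    (hp : 1 / (α * β) < p)
    (B : ℝ≥0 → Ω → ℝ) (hB : IsBifractionalBrownianMotion α β B P)
    (hcont : ∀ᵐ ω ∂P, ContinuousOn (samplePath B ω) (Set.Icc 0 1)) :
    (∀ᵐ ω ∂P, samplePath B ω ∈ Bes (α * β) p (Set.Icc 0 1)) ∧
      (∀ᵐ ω ∂P, samplePath B ω ∉ bes (α * β) p (Set.Icc 0 1)) := by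
  have hγ0 : 0 < α * β := by positivity
  -- The assumption on p enters as p ≥ 1, needed for Minkowski's inequality and the mean value bound
  -- on p-th powers.
  have hp1 : 1 ≤ p := by
    have : 1 ≤ 1 / (α * β) := by
      rw [le_div_iff₀ hγ0]
      nlinarith
    linarith
  obtain ⟨c, hc, hae⟩ := hB.ae_incrementEnergy_bounds hα0 hα1 hβ0 hβ1 hp1 hcont
  rw [← eventually_and]
  filter_upwards [hae, hcont] with ω hω hcω
  obtain ⟨⟨K, hK⟩, hlow⟩ := hω
  -- The path is known to be continuous only on [0, 1]; its constant extension beyond the endpoints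
  -- is continuous on the line.
  let g : ℝ → ℝ := Set.IccExtend zero_le_one ((Set.Icc (0 : ℝ) 1).domRestrict (samplePath B ω))
  have hg : Continuous g := (continuousOn_iff_continuous_domRestrict.1 hcω).Icc_extend'
  have hfg : Set.EqOn (samplePath B ω) g (Set.Icc 0 1) := fun x hx => by
    simp [g, Set.IccExtend_of_mem _ _ hx]
  have hE : ∀ n : ℕ, incrementEnergy (α * β) p ((1 / 2) ^ n) (samplePath B ω)
      = incrementEnergy (α * β) p ((1 / 2) ^ n) g := fun n =>
    incrementEnergy_congr (by positivity) hfg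
  simp_rw [hE] at hK hlow
  rw [mem_Bes_congr hfg, mem_bes_congr hfg]
  exact ⟨mem_Bes_of_incrementEnergy_le hγ0 hp1 hg hK,
    notMem_bes_of_le_incrementEnergy hp1 hg hc hlow⟩
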